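/- **Formula-satisfying game.** An instance $\mathcal F=(\tau,F_R,F_C,\alpha)$ consists of finite disjoint sets of variables $C,R$, a player $\tau\in\{\mathrm I,\mathrm{II}\}$ who is to move, two formulas $F_R,F_C$ over $C\cup R$ in 12-DNF (finite disjunctions of clauses, each clause a conjunction of at most 12 literals) and an assignment $\alpha:C\cup R\to\{0,1\}$. Player I, to move at an assignment under which $F_C$ is false, changes the value of at most one variable in $R$; player II, to move at an assignment under which $F_R$ is false, changes the value of at most one variable in $C$. The players alternate. A player to move who has no legal move (the opponent's formula is true) has lost; player I wins $\mathcal F$ if he can force this for player II in finitely many moves (an infinite play is not a win for player I). **Guarding game with prescribed starting positions.** $\mathcal G=(\vec G,V_C,c,S,r)$ consists of a finite directed graph $\vec G$, a cop-region $V_C\subset V(\vec G)$ with robber-region $V_R=V(\vec G)\setminus V_C$, a number $c$ of cops, their starting positions $S:\{1,\dots,c\}\to V_C$ and Robber's starting vertex $r\in V_R$. Robber moves first, then the players alternate. Robber stays or moves along an edge, to a vertex with no cop on it; in a turn of the cops every cop stays or moves along an edge within $V_C$. The robber-player wins if he can force Robber into $V_C$ in finitely many turns. **Sizes.** $|\mathcal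 F|$ and $|\mathcal G|$ are lengths in bits of binary encodings: $\mathcal F$ is encoded by $\tau$, the values of $\alpha$ and the lists of clauses as lists of literals, with variable names of $\lceil\log_2(|C|+|R|)\rceil$ bits; $\mathcal G$ is encoded by the adjacency lists of $\vec G$, the membership of every vertex in $V_C$, the list $S$ and $r$, with vertex names of $\lceil\log_2|V(\vec G)|\rceil$ bits. All lists are self-delimiting (one bit before each item and one at the end). **The game $\mathcal G(\mathcal F)$.** The graph is put together from the following gadgets; vertices of the same name are identified. Write $S_2=\{RM,RT,CM,RW,CT\}\cup\{Sw_y: y\in R\}\subseteq V_R$ and $S_1=S_2\setminus\{CT\}$. For $u\in S_2$ and $X\subseteq V_C$, $\mathrm{BLOCK}(u,X)$ consists of new vertices $p\in V_R$, $q\in V_C$ and the edges $(u,p)$, $(p,q)$ and $(s,q)$ for $s\in X$. For $U\subseteq S_2$ and $X\subseteq V_C$, $\mathrm{FORCE}(U,X)$ consists of a new vertex $f\in V_R$ and new vertices $\bar v\in V_R$ $(v\in X)$ with the edges $(u,f)$ for $u\in U$ and $(f,\bar v),(\bar v,v)$ for $v\in X$. 1. The directed cycle $(RM,RT,CM,RW,CT)$,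 and for every $y\in R$ the edges $(RM,Sw_y),(Sw_y,RT)$. 2. For every variable $x$ a directed cycle $(T_x,FT_x,F_x,TF_x)$ in $V_C$. 3. For every clause $\varphi$ of $F_R$ the gadget $\mathrm{BLOCK}(RT,\{T_x:\neg x\in\varphi\}\cup\{F_x: x\in\varphi\})$; its vertex $q$ is called $z_\varphi$. 4. A vertex $a''\in V_C$ with edges to all $z_\varphi$; for every clause $\psi$ of $F_C$ a directed cycle $(a_\psi,a'_\psi,a'',a'''_\psi)$ in $V_C$ and, for every literal $\ell$ of $\psi$, the gadget $\mathrm{BLOCK}(CT,\{t_\ell,a_\psi,a''\})$, where $t_\ell=T_x$ if $\ell=x$ and $t_\ell=F_x$ if $\ell=\neg x$. 5. A vertex $HQ\in V_C$ and for every variable $x$ vertices $G_x,GT_x,GF_x\in V_C$ with the edges $(HQ,G_x),(G_x,HQ),(G_x,GT_x),(GT_x,T_x),(G_x,GF_x),(GF_x,F_x)$. 6. For every $y\in R$ the gadgets $\mathrm{BLOCK}(Sw_y,\{FT_y,TF_y\})$ and $\mathrm{BLOCK}(Sw_y,\{G_y\})$; further $\mathrm{BLOCK}(CM,\{HQ\}\cup\{G_x:x\in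 C\})$ and, for $u\in\{RM,RT,RW,CT\}$, $\mathrm{BLOCK}(u,\{HQ\})$. 7. $\mathrm{FORCE}(S_2,\{T_x\}_{x})$, $\mathrm{FORCE}(S_2,\{F_x\}_{x})$, $\mathrm{FORCE}(S_1,\{a_\psi\}_{\psi})$ and $\mathrm{FORCE}(S_1,\{a''\})$, where the edge $(f,\overline{a''})$ of the last one is omitted if $F_C$ has no clause. 8. A vertex $r\in V_R$ with one edge, to $CT$ if $\tau=\mathrm I$ and to $RT$ if $\tau=\mathrm{II}$. Robber starts on $r$. There are $c=|C\cup R|+|F_C|+1$ cops ($|F_C|$ the number of clauses): for each variable $x$ one cop starts on $T_x$ if $\alpha(x)=1$ and on $F_x$ otherwise, for each clause $\psi$ of $F_C$ one cop starts on $a_\psi$, and one cop starts on $HQ$. **Theorem.** There is a constant $K$ such that for every instance $\mathcal F$ of the formula-satisfying game, the guarding game $\mathcal G=\mathcal G(\mathcal F)=(\vec G,V_C,c,S,r)$ with prescribed starting positions has the following properties. Player I wins $\mathcal F$ if and only if the robber-player wins $\mathcal G$. Moreover: 1. $|\mathcal G|\le K\,|\mathcal F|\log_2|\mathcal F|$,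 for every numbering of the vertices of $\vec G$. 2. No edge of $\vec G$ ends in $r$. 3. $S$ is injective, that is, at most one cop starts at each vertex. 4. Every vertex of the border $B=\{u\in V_R:\exists v\in V_C,\ (u,v)\in E(\vec G)\}$ has out-degree exactly $1$. -/

import Mathlib

/-! ### Self-delimiting binary encodings -/

/-- The `w` lowest binary digits of `k`. -/
def fixedBits (w k : ℕ) : List Bool := List.ofFn fun i : Fin w => k.testBit i

/-- Encoding of a list: every item is preceded by the bit `1`, and the list ends with the bit `0`. -/
def encodeListWith {α : Type} (enc : α → List Bool) (l : List α) : List Bool :=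
  l.flatMap (fun a => true :: enc a) ++ [false]

/-! ### The guarding game with prescribed starting positions -/

/-- A guarding game `(G, V_C, c, S, r)` on a finite directed graph with prescribed starting
positions. The robber-region is the complement of `copRegion`. -/
structure GuardingGame where
  V : Type
  [fintypeV : Fintype V]
  graph : Digraph V
  copRegion : Set V
  c : ℕ
  S : Fin c → V
  r : V
  S_mem : ∀ i, S i ∈ copRegion
  r_mem : r ∉ copRegion

namespace GuardingGame

attribute [instance] GuardingGame.fintypeV

variable (𝒢 : GuardingGame)

/-- Robber, standing on `u`, stays or moves along an edge, to a vertex `u'` with no cop on it;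
the cops stand at `s`. -/
def RobberMove (s : Fin 𝒢.c → 𝒢.V) (u u' : 𝒢.V) : Prop :=
  (u' = u ∨ 𝒢.graph.Adj u u') ∧ ∀ i, s i ≠ u'

/-- Every cop stays or moves along an edge, inside the cop-region. -/
def CopMove (s s' : Fin 𝒢.c → 𝒢.V) : Prop :=
  ∀ i, (s' i = s i ∨ 𝒢.graph.Adj (s i) (s' i)) ∧ s' i ∈ 𝒢.copRegion

/-- Robber stands on `u`, the cops stand at `s`, it is Robber's turn, and the robber-player can
force Robber to enter the cop-region after finitely many turns. -/
inductive RobberWinsFrom : 𝒢.V → (Fin 𝒢.c → 𝒢.V) → Prop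
  | enter (u u' : 𝒢.V) (s : Fin 𝒢.c → 𝒢.V) :
      𝒢.RobberMove s u u' → u' ∈ 𝒢.copRegion → RobberWinsFrom u s
  | step (u u' : 𝒢.V) (s : Fin 𝒢.c → 𝒢.V) :
      𝒢.RobberMove s u u' → u' ∉ 𝒢.copRegion →
      (∀ s', 𝒢.CopMove s s' → RobberWinsFrom u' s') → RobberWinsFrom u s

/-- The robber-player wins from the prescribed starting positions (Robber is to move). -/
def RobberWins : Prop := 𝒢.RobberWinsFrom 𝒢.r 𝒢.S

/-- The border vertices: vertices of the robber-region with an edge into the cop-region. -/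
def border : Set 𝒢.V := {u | u ∉ 𝒢.copRegion ∧ ∃ v ∈ 𝒢.copRegion, 𝒢.graph.Adj u v}

/-- The out-degree of a vertex. -/
noncomputable def outDegree (u : 𝒢.V) : ℕ := Set.ncard {v | 𝒢.graph.Adj u v}

/-- Number of bits of a vertex name. -/
def nameWidth : ℕ := Nat.clog 2 (Fintype.card 𝒢.V)

open Classical in
/-- Binary encoding of the game with respect to a numbering `e` of the vertices: for every vertex,
one bit for membership in the cop-region and the list of its out-neighbours; then the list of the
starting positions of the cops; then the starting position of Robber. -/
noncomputable def encode (e : 𝒢.V ≃ Fin (Fintype.card 𝒢.V)) : List Bool :=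
  encodeListWith
      (fun i => decide (e.symm i ∈ 𝒢.copRegion) ::
        encodeListWith (fun j : Fin (Fintype.card 𝒢.V) => fixedBits 𝒢.nameWidth j)
          ((List.finRange (Fintype.card 𝒢.V)).filter
            fun j => decide (𝒢.graph.Adj (e.symm i) (e.symm j))))
      (List.finRange (Fintype.card 𝒢.V)) ++
    encodeListWith (fun k => fixedBits 𝒢.nameWidth (e (𝒢.S k))) (List.finRange 𝒢.c) ++
    fixedBits 𝒢.nameWidth (e 𝒢.r)

end GuardingGame

/-! ### The formula-satisfying game -/

/-- The two players. -/
inductive Player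
  | I
  | II

/-- A position `(τ, F_R, F_C, α)` of the formula-satisfying game. The variables are the disjoint
union of `C` (with `nC` elements, left summand) and `R` (with `nR` elements, right summand). A
literal is a variable with the value that makes the literal true; a clause is a conjunction of at
most 12 literals; a formula is a disjunction of clauses. -/
structure FormulaGame where
  nC : ℕ
  nR : ℕ
  τ : Player
  FR : List (List ((Fin nC ⊕ Fin nR) × Bool))
  FC : List (List ((Fin nC ⊕ Fin nR) × Bool))
  FR_le : ∀ φ ∈ FR, φ.length ≤ 12
  FC_le : ∀ ψ ∈ FC, ψ.length ≤ 12
  α : Fin nC ⊕ Fin nR → Bool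

namespace FormulaGame

variable (ℱ : FormulaGame)

/-- The variables of the game. -/
abbrev Var : Type := Fin ℱ.nC ⊕ Fin ℱ.nR

/-- Truth of a formula in disjunctive normal form under an assignment. -/
def Holds (Φ : List (List (ℱ.Var × Bool))) (β : ℱ.Var → Bool) : Prop :=
  ∃ φ ∈ Φ, ∀ l ∈ φ, β l.1 = l.2

/-- The legal moves. Player I changes at most one variable of `R`, provided that `F_C` is false;
player II changes at most one variable of `C`, provided that `F_R` is false. -/
inductive Move : Player × (ℱ.Var → Bool) → Player × (ℱ.Var → Bool) → Prop
  | one (β β' : ℱ.Var → Bool) : ¬ ℱ.Holds ℱ.FC β → (∀ x, β' (.inl x) = β (.inl x)) →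
      {y | β' (.inr y) ≠ β (.inr y)}.Subsingleton → Move (.I, β) (.II, β')
  | two (β β' : ℱ.Var → Bool) : ¬ ℱ.Holds ℱ.FR β → (∀ y, β' (.inr y) = β (.inr y)) →
      {x | β' (.inl x) ≠ β (.inl x)}.Subsingleton → Move (.II, β) (.I, β')

/-- Player I can force a win in finitely many moves; a player who cannot move has lost, because
the formula of the opponent is true. -/
inductive WinsI : Player × (ℱ.Var → Bool) → Prop
  | one (β : ℱ.Var → Bool) (q : Player × (ℱ.Var → Bool)) :
      ℱ.Move (.I, β) q → WinsI q → WinsI (.I, β)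
  | two (β : ℱ.Var → Bool) : (∀ q, ℱ.Move (.II, β) q → WinsI q) → WinsI (.II, β)

/-- Player I wins the given instance. -/
def PlayerIWins : Prop := ℱ.WinsI (ℱ.τ, ℱ.α)

/-- Encoding of a literal: its sign and the name of its variable. -/
def encodeLiteral (l : ℱ.Var × Bool) : List Bool :=
  l.2 :: fixedBits (Nat.clog 2 (ℱ.nC + ℱ.nR)) (finSumFinEquiv l.1)

/-- Binary encoding of the instance: the player to move, the assignment on `C` and on `R`, and the
two formulas. -/
def encode : List Bool :=
  (match ℱ.τ with | .I => false | .II => true) ::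
    (encodeListWith (fun x => [ℱ.α (.inl x)]) (List.finRange ℱ.nC) ++
      encodeListWith (fun y => [ℱ.α (.inr y)]) (List.finRange ℱ.nR) ++
      encodeListWith (encodeListWith ℱ.encodeLiteral) ℱ.FR ++
      encodeListWith (encodeListWith ℱ.encodeLiteral) ℱ.FC)

/-! ### The guarding game constructed from a formula-satisfying game -/

/-- The normal positions of Robber: the Basic Cycle and the vertices `Sw_y` for `y ∈ R`. -/
inductive Station
  | RM
  | RT
  | CM
  | RW
  | CT
  | Sw (y : Fin ℱ.nR)
  deriving DecidableEq, Fintype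

/-- Names of the Blocker gadgets. -/
inductive Blocker
  /-- the Robber Gate of a clause `φ` of `F_R` -/
  | robberGate (φ : Fin ℱ.FR.length)
  /-- the blocker of the `i`-th literal in the Cop Gate of a clause `ψ` of `F_C` -/
  | copGate (ψ : Fin ℱ.FC.length) (i : Fin (ℱ.FC.get ψ).length)
  /-- the blocker of the Robber Switch of `y ∈ R` -/
  | robberSwitch (y : Fin ℱ.nR)
  /-- the blocker that controls Commander while Robber is on a given normal position -/
  | command (s : ℱ.Station)
  deriving DecidableEq, Fintype

/-- The vertices of the constructed graph. -/
inductive Vertex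
  /-- the starting vertex of Robber -/
  | start
  | station (s : ℱ.Station)
  /-- the vertices `p` and `q` of a Blocker -/
  | p (b : ℱ.Blocker)
  | q (b : ℱ.Blocker)
  /-- the forcing vertices, and for every forced vertex `v` the vertex `v̄` -/
  | forceT
  | forceF
  | forceA
  | forceA''
  | barT (x : ℱ.Var)
  | barF (x : ℱ.Var)
  | barA (ψ : Fin ℱ.FC.length)
  | barA''
  /-- the Variable Cells -/
  | T (x : ℱ.Var)
  | FT (x : ℱ.Var)
  | F (x : ℱ.Var)
  | TF (x : ℱ.Var)
  /-- the cycles of the Cop Gates; `a''` is shared by all clauses -/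
  | a (ψ : Fin ℱ.FC.length)
  | a' (ψ : Fin ℱ.FC.length)
  | a''
  | a''' (ψ : Fin ℱ.FC.length)
  /-- the Commander gadget -/
  | HQ
  | G (x : ℱ.Var)
  | GT (x : ℱ.Var)
  | GF (x : ℱ.Var)
  deriving DecidableEq, Fintype

variable {ℱ}

/-- The cop-region of the constructed game. -/
def Vertex.InCopRegion : ℱ.Vertex → Prop
  | .q _ | .T _ | .FT _ | .F _ | .TF _ | .a _ | .a' _ | .a'' | .a''' _
  | .HQ | .G _ | .GT _ | .GF _ => True
  | _ => False

/-- The vertex of the Variable Cell of `x` that represents the value `b`. -/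
def Vertex.value (x : ℱ.Var) (b : Bool) : ℱ.Vertex := if b then .T x else .F x

/-- The vertex `u` of a Blocker `BLOCK(u, S)`. -/
def Blocker.source : ℱ.Blocker → ℱ.Station
  | .robberGate _ => .RT
  | .copGate _ _ => .CT
  | .robberSwitch y => .Sw y
  | .command s => s

/-- The set `S` of a Blocker `BLOCK(u, S)`. -/
def Blocker.blocked : ℱ.Blocker → Set ℱ.Vertex
  | .robberGate φ => {v | ∃ l ∈ ℱ.FR.get φ, v = .value l.1 (!l.2)}
  | .copGate ψ i =>
      {.value ((ℱ.FC.get ψ).get i).1 ((ℱ.FC.get ψ).get i).2, .a ψ, .a''}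
  | .robberSwitch y => {.FT (.inr y), .TF (.inr y)}
  | .command (.Sw y) => {.G (.inr y)}
  | .command .CM => {v | v = .HQ ∨ ∃ x : Fin ℱ.nC, v = .G (.inl x)}
  | .command _ => {.HQ}

variable (ℱ)

/-- The edges of the constructed graph. -/
inductive Edge : ℱ.Vertex → ℱ.Vertex → Prop
  /-- Robber's first move leads to the test of the formula of the player who is not to move. -/
  | start_CT : ℱ.τ = .I → Edge .start (.station .CT)
  | start_RT : ℱ.τ = .II → Edge .start (.station .RT)
  /-- Basic Cycle -/
  | RM_RT : Edge (.station .RM) (.station .RT)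
  | RT_CM : Edge (.station .RT) (.station .CM)
  | CM_RW : Edge (.station .CM) (.station .RW)
  | RW_CT : Edge (.station .RW) (.station .CT)
  | CT_RM : Edge (.station .CT) (.station .RM)
  /-- Robber Switches -/
  | RM_Sw (y : Fin ℱ.nR) : Edge (.station .RM) (.station (.Sw y))
  | Sw_RT (y : Fin ℱ.nR) : Edge (.station (.Sw y)) (.station .RT)
  /-- Blockers -/
  | source_p (b : ℱ.Blocker) : Edge (.station b.source) (.p b)
  | p_q (b : ℱ.Blocker) : Edge (.p b) (.q b)
  | blocked_q (b : ℱ.Blocker) (v : ℱ.Vertex) : v ∈ b.blocked → Edge v (.q b)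
  /-- Enforcer gadgets -/
  | station_forceT (s : ℱ.Station) : Edge (.station s) .forceT
  | station_forceF (s : ℱ.Station) : Edge (.station s) .forceF
  | station_forceA (s : ℱ.Station) : s ≠ .CT → Edge (.station s) .forceA
  | station_forceA'' (s : ℱ.Station) : s ≠ .CT → Edge (.station s) .forceA''
  | forceT_barT (x : ℱ.Var) : Edge .forceT (.barT x)
  | forceF_barF (x : ℱ.Var) : Edge .forceF (.barF x)
  | forceA_barA (ψ : Fin ℱ.FC.length) : Edge .forceA (.barA ψ)
  | forceA''_barA'' : ℱ.FC ≠ [] → Edge .forceA'' .barA''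
  | barT_T (x : ℱ.Var) : Edge (.barT x) (.T x)
  | barF_F (x : ℱ.Var) : Edge (.barF x) (.F x)
  | barA_a (ψ : Fin ℱ.FC.length) : Edge (.barA ψ) (.a ψ)
  | barA''_a'' : Edge .barA'' .a''
  /-- Variable Cells -/
  | T_FT (x : ℱ.Var) : Edge (.T x) (.FT x)
  | FT_F (x : ℱ.Var) : Edge (.FT x) (.F x)
  | F_TF (x : ℱ.Var) : Edge (.F x) (.TF x)
  | TF_T (x : ℱ.Var) : Edge (.TF x) (.T x)
  /-- Cop Gates -/
  | a_a' (ψ : Fin ℱ.FC.length) : Edge (.a ψ) (.a' ψ)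
  | a'_a'' (ψ : Fin ℱ.FC.length) : Edge (.a' ψ) .a''
  | a''_a''' (ψ : Fin ℱ.FC.length) : Edge .a'' (.a''' ψ)
  | a'''_a (ψ : Fin ℱ.FC.length) : Edge (.a''' ψ) (.a ψ)
  | a''_z (φ : Fin ℱ.FR.length) : Edge .a'' (.q (.robberGate φ))
  /-- Commander gadget -/
  | HQ_G (x : ℱ.Var) : Edge .HQ (.G x)
  | G_HQ (x : ℱ.Var) : Edge (.G x) .HQ
  | G_GT (x : ℱ.Var) : Edge (.G x) (.GT x)
  | GT_T (x : ℱ.Var) : Edge (.GT x) (.T x)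
  | G_GF (x : ℱ.Var) : Edge (.G x) (.GF x)
  | GF_F (x : ℱ.Var) : Edge (.GF x) (.F x)

/-- Starting positions of the cops: one variable cop for every variable of `C` and of `R`, one cop
for every clause of `F_C`, and Commander. -/
def copStart : Fin (ℱ.nC + ℱ.nR + ℱ.FC.length + 1) → ℱ.Vertex :=
  Fin.append
    (Fin.append
      (Fin.append (fun x => .value (.inl x) (ℱ.α (.inl x)))
        (fun y => .value (.inr y) (ℱ.α (.inr y))))
      (fun ψ => .a ψ))
    (fun _ => .HQ)

theorem copStart_inCopRegion (i : Fin (ℱ.nC + ℱ.nR + ℱ.FC.length + 1)) :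
    (ℱ.copStart i).InCopRegion := by
  have hv : ∀ (x : ℱ.Var) (b : Bool), (Vertex.value x b).InCopRegion := by
    intro x b
    cases b <;> exact trivial
  unfold copStart
  refine Fin.addCases (fun i => ?_) (fun i => ?_) i
  · rw [Fin.append_left]
    refine Fin.addCases (fun i => ?_) (fun i => ?_) i
    · rw [Fin.append_left]
      refine Fin.addCases (fun i => ?_) (fun i => ?_) i
      · rw [Fin.append_left]
        exact hv _ _
      · rw [Fin.append_right]
        exact hv _ _
    · rw [Fin.append_right]
      exact trivial
  · rw [Fin.append_right]
    exact trivial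

/-- The guarding game with prescribed starting positions constructed from `ℱ`. -/
def toGuardingGame : GuardingGame where
  V := ℱ.Vertex
  graph := ⟨ℱ.Edge⟩
  copRegion := {v | v.InCopRegion}
  c := ℱ.nC + ℱ.nR + ℱ.FC.length + 1
  S := ℱ.copStart
  r := .start
  S_mem := ℱ.copStart_inCopRegion
  r_mem := fun h => h

end FormulaGame

/-! An assignment is encoded by the position with every variable cop on T_x or F_x, every clause cop
on a_ψ and Commander on HQ (`Squad.representing`). Each lap of Robber around the basic cycle plays
one round: from RM he may detour through Sw_y to change y, at RT he tests F_R, at CM the cops may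
change one variable of C, and at CT they may exploit that F_C is true.

If player I wins, Robber wins because every deviation of the cops loses quickly. A blocker is lost
when no cop can be on q after one move (`Squad.wins_of_blocker`), an enforcer when none can reach
its target in two (`Squad.wins_of_enforcer`). Only Commander can serve the `command` blockers, so
his position is dictated at every station. Unless he is on G_x, the cop of x must be on T_x or F_x,
and passing from one to the other takes two moves. So x changes only while Commander is on G_x.
Except at CT the clause cops are pinned to a_ψ. An induction on `WinsI` then transfers the win
(`Squad.target_of_winsI`). Its statement `Squad.Target` is asymmetric: with player II to move the
cops stand exactly on a representing position and Robber on RT; with player I to move Robber is on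
CT, where clause cops may have strayed.

Conversely, the positions that player I does not win give an invariant, so infinite plays need no
separate treatment. The cops mirror the formula game (`Squad.Patrol`). If F_C is true when Robber
comes to CT, a clause cop starts for a'' and from there covers all gates for ever. Off the stations
the cops only count down the moves needed to close a blocker or an enforcer (`Squad.Holding`).

For the size, the numbers of vertices and edges are linear in the number of variables, clauses and
literals, hence in the length of the instance, and each name has logarithmic width. -/

/-- An invariant that the cops can maintain and under which Robber never enters the cop-region. -/
theorem GuardingGame.not_robberWinsFrom_of_invariant (𝒢 : GuardingGame)
    (Safe : 𝒢.V → (Fin 𝒢.c → 𝒢.V) → Prop)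
    (hSafe : ∀ u s v, Safe u s → 𝒢.RobberMove s u v →
      v ∉ 𝒢.copRegion ∧ ∃ s', 𝒢.CopMove s s' ∧ Safe v s')
    (u : 𝒢.V) (s : Fin 𝒢.c → 𝒢.V) (h : Safe u s) : ¬ 𝒢.RobberWinsFrom u s := by
  intro hW
  induction hW with
  | enter u v s hm hv => exact (hSafe u s v h hm).1 hv
  | step u v s hm hv _ ih =>
    obtain ⟨-, s', hs', hS⟩ := hSafe u s v h hm
    exact ih s' hs' hS

namespace FormulaGame

variable {ℱ : FormulaGame}

/-! ### Neighbourhoods in the constructed graph -/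

/-- The vertex of the Variable Cell of `x` that follows the vertex for the value `b`. -/
def Vertex.half (x : ℱ.Var) (b : Bool) : ℱ.Vertex := if b then .FT x else .TF x

theorem Vertex.value_inCopRegion (x : ℱ.Var) (b : Bool) : (Vertex.value x b).InCopRegion := by
  cases b <;> trivial

theorem Vertex.half_inCopRegion (x : ℱ.Var) (b : Bool) : (Vertex.half x b).InCopRegion := by
  cases b <;> trivial

theorem Edge.value_half (x : ℱ.Var) (b : Bool) : ℱ.Edge (.value x b) (.half x b) := by
  cases b
  · exact .F_TF x
  · exact .T_FT x

theorem Edge.half_value (x : ℱ.Var) (b : Bool) : ℱ.Edge (.half x b) (.value x (!b)) := by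
  cases b
  · exact .TF_T x
  · exact .FT_F x

/-- The vertices that only Commander can occupy. -/
def Vertex.CommandZone : ℱ.Vertex → Prop
  | .HQ | .G _ | .q (.command _) => True
  | _ => False

theorem Blocker.blocked_command {s : ℱ.Station} {v : ℱ.Vertex}
    (h : v ∈ (Blocker.command s).blocked) : v = .HQ ∨ ∃ x, v = .G x := by
  cases s <;> simp [Blocker.blocked] at h <;> aesop

/-- The zone can be entered only from HQ or some G_x, which belong to it themselves, so a cop
outside it never gets in. The condition on `u` rules out the vertex p of a blocker. -/
theorem Edge.commandZone {u v : ℱ.Vertex} (h : ℱ.Edge u v) (hv : v.CommandZone)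
    (hu : u.InCopRegion) :
    u = .HQ ∨ ∃ x, u = .G x := by
  cases h with
  | blocked_q b v hb =>
    cases b <;> simp only [Vertex.CommandZone] at hv
    exact Blocker.blocked_command hb
  | p_q b => exact hu.elim
  | HQ_G x => exact .inl rfl
  | G_HQ x => exact .inr ⟨x, rfl⟩
  | _ => exact hv.elim

theorem Edge.into_q {u : ℱ.Vertex} {b : ℱ.Blocker} (h : ℱ.Edge u (.q b)) (hu : u.InCopRegion) :
    u ∈ b.blocked ∨ (u = .a'' ∧ ∃ φ, b = .robberGate φ) := by
  cases h with
  | p_q b => exact hu.elim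
  | blocked_q b v hb => exact .inl hb
  | a''_z φ => exact .inr ⟨rfl, φ, rfl⟩

theorem Edge.into_T {u : ℱ.Vertex} {x : ℱ.Var} (h : ℱ.Edge u (.T x)) (hu : u.InCopRegion) :
    u = .TF x ∨ u = .GT x := by
  cases h with
  | barT_T => exact hu.elim
  | TF_T => exact .inl rfl
  | GT_T => exact .inr rfl

theorem Edge.into_F {u : ℱ.Vertex} {x : ℱ.Var} (h : ℱ.Edge u (.F x)) (hu : u.InCopRegion) :
    u = .FT x ∨ u = .GF x := by
  cases h with
  | barF_F => exact hu.elim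
  | FT_F => exact .inl rfl
  | GF_F => exact .inr rfl

theorem Edge.into_a {u : ℱ.Vertex} {ψ : Fin ℱ.FC.length} (h : ℱ.Edge u (.a ψ))
    (hu : u.InCopRegion) : u = .a''' ψ := by
  cases h with
  | barA_a => exact hu.elim
  | a'''_a => rfl

theorem Edge.into_start {u : ℱ.Vertex} : ¬ ℱ.Edge u .start := nofun

theorem Vertex.value_inj {x z : ℱ.Var} {b d : Bool} (h : (Vertex.value x b) = .value z d) :
    x = z ∧ b = d := by
  cases b <;> cases d <;> simp_all [Vertex.value]

/-- A cop inside the Variable Cell of `x` stays there or leaves to a vertex `q`. -/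
theorem Edge.from_value {x : ℱ.Var} {b : Bool} {v : ℱ.Vertex} (h : ℱ.Edge (.value x b) v) :
    v = .half x b ∨ ∃ d : ℱ.Blocker, v = .q d ∧ .value x b ∈ d.blocked := by
  generalize hu : Vertex.value x b = u at h
  cases h <;> first
    | exact .inr ⟨_, rfl, by assumption⟩
    | (cases b <;> simp_all [Vertex.value, Vertex.half])

theorem Edge.from_half {x : ℱ.Var} {b : Bool} {v : ℱ.Vertex} (h : ℱ.Edge (.half x b) v) :
    v = .value x (!b) ∨ ∃ d : ℱ.Blocker, v = .q d ∧ .half x b ∈ d.blocked := by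
  generalize hu : Vertex.half x b = u at h
  cases h <;> first
    | exact .inr ⟨_, rfl, by assumption⟩
    | (cases b <;> simp_all [Vertex.value, Vertex.half])

theorem Edge.from_a {ψ : Fin ℱ.FC.length} {v : ℱ.Vertex} (h : ℱ.Edge (.a ψ) v) :
    v = .a' ψ ∨ ∃ i, v = .q (.copGate ψ i) := by
  cases h with
  | a_a' => exact .inl rfl
  | blocked_q b _ hb =>
    right
    cases b with
    | robberGate φ =>
      obtain ⟨l, -, hl⟩ := hb
      unfold Vertex.value at hl
      split at hl <;> cases hl
    | copGate ψ' i =>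
      simp only [Blocker.blocked, Vertex.value, Set.mem_insert_iff, Set.mem_singleton_iff] at hb
      split at hb <;> simp at hb <;> subst hb <;> exact ⟨i, rfl⟩
    | robberSwitch y => simp [Blocker.blocked] at hb
    | command s => simpa using Blocker.blocked_command hb

theorem Blocker.blocked_inCopRegion {b : ℱ.Blocker} {v : ℱ.Vertex} (h : v ∈ b.blocked) :
    v.InCopRegion := by
  cases b with
  | robberGate φ =>
    obtain ⟨l, -, rfl⟩ := h
    exact Vertex.value_inCopRegion _ _
  | copGate ψ i =>
    rcases h with rfl | rfl | rfl
    · exact Vertex.value_inCopRegion _ _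
    all_goals trivial
  | robberSwitch y => rcases h with rfl | rfl <;> trivial
  | command s =>
    rcases blocked_command h with rfl | ⟨x, rfl⟩ <;> trivial

/-- The vertices q are sinks: a cop that closes a blocker is stuck there for the rest of the play.
-/
theorem Edge.from_q {b : ℱ.Blocker} {v : ℱ.Vertex} : ¬ ℱ.Edge (.q b) v := by
  intro h
  cases h with
  | blocked_q d _ hd =>
    cases d with
    | robberGate φ =>
      obtain ⟨l, -, hl⟩ := hd
      unfold Vertex.value at hl
      split at hl <;> cases hl
    | copGate ψ i =>
      rcases hd with hl | hl | hl
      · unfold Vertex.value at hl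
        split at hl <;> cases hl
      all_goals cases hl
    | robberSwitch y => rcases hd with hl | hl <;> cases hl
    | command s => rcases Blocker.blocked_command hd with hl | ⟨_, hl⟩ <;> cases hl

/-! ### Positions of the cops, indexed by their roles -/

variable (ℱ) in
/-- The positions of the cops: one for every variable, one for every clause of `F_C`, and
Commander. -/
@[ext] structure Squad where
  var : ℱ.Var → ℱ.Vertex
  clause : Fin ℱ.FC.length → ℱ.Vertex
  commander : ℱ.Vertex

variable (ℱ) in
/-- The roles of the cops. -/
def roleEquiv :
    Fin (ℱ.nC + ℱ.nR + ℱ.FC.length + 1) ≃ (ℱ.Var ⊕ Fin ℱ.FC.length) ⊕ Fin 1 :=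
  finSumFinEquiv.symm.trans (Equiv.sumCongr
    (finSumFinEquiv.symm.trans (Equiv.sumCongr finSumFinEquiv.symm (Equiv.refl _)))
    (Equiv.refl _))

namespace Squad

/-- The position of the cop with a given role. -/
def pos (σ : ℱ.Squad) : (ℱ.Var ⊕ Fin ℱ.FC.length) ⊕ Fin 1 → ℱ.Vertex
  | .inl (.inl x) => σ.var x
  | .inl (.inr ψ) => σ.clause ψ
  | .inr _ => σ.commander

/-- The positions as a function of the number of the cop. -/
def toFun (σ : ℱ.Squad) (i : Fin (ℱ.nC + ℱ.nR + ℱ.FC.length + 1)) : ℱ.Vertex :=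
  σ.pos (ℱ.roleEquiv i)

/-- Some cop stands on a vertex with the property `P`. -/
def Any (σ : ℱ.Squad) (P : ℱ.Vertex → Prop) : Prop :=
  (∃ x, P (σ.var x)) ∨ (∃ ψ, P (σ.clause ψ)) ∨ P σ.commander

theorem exists_toFun_iff (σ : ℱ.Squad) (P : ℱ.Vertex → Prop) :
    (∃ i, P (σ.toFun i)) ↔ σ.Any P := by
  unfold toFun
  rw [← ℱ.roleEquiv.surjective.exists (p := fun k => P (σ.pos k))]
  simp [pos, Any, Sum.exists]
  tauto

theorem exists_toFun_eq (s : Fin (ℱ.nC + ℱ.nR + ℱ.FC.length + 1) → ℱ.Vertex) :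
    ∃ σ : ℱ.Squad, σ.toFun = s := by
  refine ⟨⟨fun x => s (ℱ.roleEquiv.symm (.inl (.inl x))),
    fun ψ => s (ℱ.roleEquiv.symm (.inl (.inr ψ))), s (ℱ.roleEquiv.symm (.inr 0))⟩, ?_⟩
  funext i
  obtain ⟨k, rfl⟩ := ℱ.roleEquiv.symm.surjective i
  unfold toFun
  rw [Equiv.apply_symm_apply]
  rcases k with (x | ψ) | j
  · rfl
  · rfl
  · rw [Subsingleton.elim j 0]; rfl

end Squad

/-- A legal step of a single cop. -/
def Step (u v : ℱ.Vertex) : Prop := (v = u ∨ ℱ.Edge u v) ∧ v.InCopRegion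

theorem Step.refl {u : ℱ.Vertex} (h : u.InCopRegion) : Step u u := ⟨.inl rfl, h⟩

theorem Step.of_edge {u v : ℱ.Vertex} (h : ℱ.Edge u v) (hv : v.InCopRegion) : Step u v :=
  ⟨.inr h, hv⟩

namespace Squad

/-- A legal move of all cops. -/
structure Moves (σ σ' : ℱ.Squad) : Prop where
  var : ∀ x, Step (σ.var x) (σ'.var x)
  clause : ∀ ψ, Step (σ.clause ψ) (σ'.clause ψ)
  commander : Step σ.commander σ'.commander

/-- All cops stand in the cop-region. -/
structure Inside (σ : ℱ.Squad) : Prop where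
  var : ∀ x, (σ.var x).InCopRegion
  clause : ∀ ψ, (σ.clause ψ).InCopRegion
  commander : σ.commander.InCopRegion

theorem Moves.inside {σ σ' : ℱ.Squad} (h : σ.Moves σ') : σ'.Inside :=
  ⟨fun x => (h.var x).2, fun ψ => (h.clause ψ).2, h.commander.2⟩

theorem Inside.moves {σ : ℱ.Squad} (h : σ.Inside) : σ.Moves σ :=
  ⟨fun x => .refl (h.var x), fun ψ => .refl (h.clause ψ), .refl h.commander⟩

theorem Inside.not_any {σ : ℱ.Squad} (h : σ.Inside) {u : ℱ.Vertex} (hu : ¬ u.InCopRegion) :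
    ¬ σ.Any (· = u) := by
  rintro (⟨x, rfl⟩ | ⟨ψ, rfl⟩ | rfl)
  · exact hu (h.var x)
  · exact hu (h.clause ψ)
  · exact hu h.commander

theorem copMove_iff {σ σ' : ℱ.Squad} :
    ℱ.toGuardingGame.CopMove σ.toFun σ'.toFun ↔ σ.Moves σ' := by
  have : ℱ.toGuardingGame.CopMove σ.toFun σ'.toFun ↔ ∀ k, Step (σ.pos k) (σ'.pos k) :=
    ℱ.roleEquiv.surjective.forall (p := fun k => Step (σ.pos k) (σ'.pos k)) |>.symm
  rw [this]
  constructor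
  · intro h
    exact ⟨fun x => h (.inl (.inl x)), fun ψ => h (.inl (.inr ψ)), h (.inr 0)⟩
  · rintro h ((x | ψ) | j)
    exacts [h.var x, h.clause ψ, h.commander]

/-- The robber-player wins with Robber on `u`, the cops at `σ`, and Robber to move. -/
def Wins (u : ℱ.Vertex) (σ : ℱ.Squad) : Prop := ℱ.toGuardingGame.RobberWinsFrom u σ.toFun

theorem wins_of_enter {u v : ℱ.Vertex} {σ : ℱ.Squad} (h : ℱ.Edge u v) (hv : v.InCopRegion)
    (hσ : ¬ σ.Any (· = v)) : Wins u σ := by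
  refine GuardingGame.RobberWinsFrom.enter (𝒢 := ℱ.toGuardingGame) u v _ ⟨.inr h, ?_⟩ hv
  rwa [← exists_toFun_iff, not_exists] at hσ

theorem wins_of_step {u v : ℱ.Vertex} {σ : ℱ.Squad} (h : ℱ.Edge u v) (hv : ¬ v.InCopRegion)
    (hσ : σ.Inside) (hW : ∀ σ', σ.Moves σ' → Wins v σ') : Wins u σ := by
  refine GuardingGame.RobberWinsFrom.step (𝒢 := ℱ.toGuardingGame) u v _ ⟨.inr h, ?_⟩ hv ?_
  · have := hσ.not_any hv
    rwa [← exists_toFun_iff, not_exists] at this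
  · intro s' hm
    obtain ⟨σ', rfl⟩ := exists_toFun_eq s'
    exact hW σ' (copMove_iff.1 hm)

/-- An invariant that the cops can maintain and under which Robber never enters the cop-region. -/
theorem not_wins_of_invariant (Safe : ℱ.Vertex → ℱ.Squad → Prop)
    (hSafe : ∀ u σ v, Safe u σ → (v = u ∨ ℱ.Edge u v) → ¬ σ.Any (· = v) →
      ¬ v.InCopRegion ∧ ∃ σ', σ.Moves σ' ∧ Safe v σ')
    {u : ℱ.Vertex} {σ : ℱ.Squad} (h : Safe u σ) : ¬ Wins u σ := by
  refine ℱ.toGuardingGame.not_robberWinsFrom_of_invariant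
    (fun u s => ∃ σ : ℱ.Squad, σ.toFun = s ∧ Safe u σ) ?_ u σ.toFun ⟨σ, rfl, h⟩
  rintro u _ v ⟨σ, rfl, h⟩ hm
  obtain ⟨hv, σ', hσ', hS⟩ := hSafe u σ v h hm.1 (by
    rw [← exists_toFun_iff, not_exists]
    exact hm.2)
  exact ⟨hv, σ'.toFun, copMove_iff.2 hσ', σ', rfl, hS⟩

variable (ℱ) in
/-- The position of the cops that represents the assignment `β`. -/
def representing (β : ℱ.Var → Bool) : ℱ.Squad := ⟨fun x => .value x (β x), .a, .HQ⟩

theorem representing_inside (β : ℱ.Var → Bool) : (representing ℱ β).Inside :=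
  ⟨fun _ => Vertex.value_inCopRegion _ _, fun _ => trivial, trivial⟩

theorem copStart_eq : ℱ.copStart = (representing ℱ ℱ.α).toFun := by
  funext i
  obtain ⟨k, rfl⟩ := ℱ.roleEquiv.symm.surjective i
  unfold toFun
  rw [Equiv.apply_symm_apply]
  rcases k with ((x | y) | ψ) | j <;>
  simp [roleEquiv, copStart, pos, representing]

end Squad

/-! ### Starting positions and border vertices -/

theorem copStart_injective : Function.Injective ℱ.copStart := by
  rw [Squad.copStart_eq]
  refine Function.Injective.comp (g := (Squad.representing ℱ ℱ.α).pos) ?_ ℱ.roleEquiv.injective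
  rintro ((x | ψ) | j) ((x' | ψ') | j') h <;>
    simp only [Squad.pos, Squad.representing, Vertex.value] at h
  · split at h <;> split at h <;> simp at h <;> rw [h]
  · split at h <;> simp at h
  · split at h <;> simp at h
  · split at h <;> simp at h
  · simp at h; rw [h]
  · simp at h
  · split at h <;> simp at h
  · simp at h
  · rw [Subsingleton.elim j j']

/-- The border consists of the vertices p and v̄, each with a single outgoing edge; edges of type
`blocked_q` are excluded since they start in the cop-region. -/
theorem outDegree_border (u : ℱ.toGuardingGame.V) (hu : u ∈ ℱ.toGuardingGame.border) :
    ℱ.toGuardingGame.outDegree u = 1 := by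
  obtain ⟨hu, v, hv, h⟩ := hu
  change ¬ Vertex.InCopRegion u at hu
  change Vertex.InCopRegion v at hv
  change ℱ.Edge u v at h
  refine Set.ncard_eq_one.2 ⟨v, Set.eq_singleton_iff_unique_mem.2 ⟨h, ?_⟩⟩
  intro w hw
  change ℱ.Edge u w at hw
  cases h with
  | blocked_q b v hb => exact (hu (Blocker.blocked_inCopRegion hb)).elim
  | p_q b =>
    cases hw with
    | p_q => rfl
    | blocked_q _ _ hb => exact (hu (Blocker.blocked_inCopRegion hb)).elim
  | barT_T x =>
    cases hw with
    | barT_T => rfl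
    | blocked_q _ _ hb => exact (hu (Blocker.blocked_inCopRegion hb)).elim
  | barF_F x =>
    cases hw with
    | barF_F => rfl
    | blocked_q _ _ hb => exact (hu (Blocker.blocked_inCopRegion hb)).elim
  | barA_a x =>
    cases hw with
    | barA_a => rfl
    | blocked_q _ _ hb => exact (hu (Blocker.blocked_inCopRegion hb)).elim
  | barA''_a'' =>
    cases hw with
    | barA''_a'' => rfl
    | blocked_q _ _ hb => exact (hu (Blocker.blocked_inCopRegion hb)).elim
  | _ => first | exact (hu trivial).elim | exact hv.elim
/-! ### The strategy of the robber-player -/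

namespace Squad

theorem Moves.any {σ σ' : ℱ.Squad} (h : σ.Moves σ') {P : ℱ.Vertex → Prop} (hP : σ'.Any P) :
    σ.Any fun u => ∃ v, Step u v ∧ P v := by
  rcases hP with ⟨x, hx⟩ | ⟨ψ, hψ⟩ | hc
  · exact .inl ⟨x, _, h.var x, hx⟩
  · exact .inr (.inl ⟨ψ, _, h.clause ψ, hψ⟩)
  · exact .inr (.inr ⟨_, h.commander, hc⟩)

theorem Any.mono {σ : ℱ.Squad} {P Q : ℱ.Vertex → Prop} (h : σ.Any P) (hPQ : ∀ v, P v → Q v) :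
    σ.Any Q :=
  h.imp (fun ⟨x, hx⟩ => ⟨x, hPQ _ hx⟩) (Or.imp (fun ⟨ψ, hψ⟩ => ⟨ψ, hPQ _ hψ⟩) (hPQ _))

/-- While Robber steps to p the cops get one turn, so a cop must already be on q or next to it. -/
theorem wins_of_blocker {b : ℱ.Blocker} {σ : ℱ.Squad} (hσ : σ.Inside)
    (h : ¬ σ.Any fun v => v = .q b ∨ ℱ.Edge v (.q b)) : Wins (.station b.source) σ := by
  refine wins_of_step (.source_p b) (fun h => h) hσ fun σ' hm => ?_
  refine wins_of_enter (.p_q b) trivial fun h' => h ((hm.any h').mono ?_)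
  rintro v ⟨_, hs, rfl⟩
  exact hs.1.imp_left Eq.symm

/-- The detour through f and v̄ gives the cops two turns. The target is chosen in advance, which
already suffices for Robber. -/
theorem wins_of_enforcer {s : ℱ.Station} {f w v : ℱ.Vertex} {σ : ℱ.Squad} (hσ : σ.Inside)
    (hf : ℱ.Edge (.station s) f) (hw : ℱ.Edge f w) (hv : ℱ.Edge w v)
    (hf' : ¬ f.InCopRegion) (hw' : ¬ w.InCopRegion) (hv' : v.InCopRegion)
    (h : ¬ σ.Any fun u => ∃ m, Step u m ∧ Step m v) : Wins (.station s) σ := by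
  refine wins_of_step hf hf' hσ fun σ₁ h₁ => ?_
  refine wins_of_step hw hw' h₁.inside fun σ₂ h₂ => ?_
  refine wins_of_enter hv hv' fun h' => h ((h₁.any (h₂.any h')).mono ?_)
  rintro u ⟨m, hm, _, hs, rfl⟩
  exact ⟨m, hm, hs⟩

end Squad

/-- The possible positions of the cop of the variable `x` as long as Robber is on the stations. -/
def Vertex.InCell (x : ℱ.Var) (v : ℱ.Vertex) : Prop :=
  (∃ b, v = .value x b) ∨ (∃ b, v = .half x b) ∨ ∃ d : ℱ.Blocker, v = .q d ∧ ∀ s, d ≠ .command s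

/-- The possible positions of the cop of the clause `ψ` before `a''` is reached. -/
def Vertex.NearGate (ψ : Fin ℱ.FC.length) (v : ℱ.Vertex) : Prop :=
  v = .a ψ ∨ v = .a' ψ ∨ ∃ i, v = .q (.copGate ψ i)

theorem Vertex.InCell.not_commandZone {x : ℱ.Var} {v : ℱ.Vertex} (h : v.InCell x) :
    ¬ v.CommandZone := by
  rcases h with ⟨b, rfl⟩ | ⟨b, rfl⟩ | ⟨d, rfl, hd⟩
  · cases b <;> exact fun h => h
  · cases b <;> exact fun h => h
  · cases d with
    | command s => exact (hd s rfl).elim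
    | _ => exact fun h => h

theorem Vertex.NearGate.not_commandZone {ψ : Fin ℱ.FC.length} {v : ℱ.Vertex}
    (h : v.NearGate ψ) : ¬ v.CommandZone := by
  rcases h with rfl | rfl | ⟨i, rfl⟩ <;> exact fun h => h

theorem Vertex.InCell.inCopRegion {x : ℱ.Var} {v : ℱ.Vertex} (h : v.InCell x) :
    v.InCopRegion := by
  rcases h with ⟨b, rfl⟩ | ⟨b, rfl⟩ | ⟨d, rfl, -⟩
  exacts [value_inCopRegion _ _, half_inCopRegion _ _, trivial]

theorem Vertex.NearGate.inCopRegion {ψ : Fin ℱ.FC.length} {v : ℱ.Vertex} (h : v.NearGate ψ) :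
    v.InCopRegion := by
  rcases h with rfl | rfl | ⟨i, rfl⟩ <;> trivial

theorem Vertex.ne_command_of_mem {d : ℱ.Blocker} {v : ℱ.Vertex} (hv : ¬ v.CommandZone)
    (h : v ∈ d.blocked) (s : ℱ.Station) : d ≠ .command s := by
  rintro rfl
  rcases Blocker.blocked_command h with rfl | ⟨x, rfl⟩ <;> exact hv trivial

theorem Step.not_commandZone {u v : ℱ.Vertex} (h : Step u v) (hu' : u.InCopRegion)
    (hu : ¬ u.CommandZone) : ¬ v.CommandZone := by
  rcases h.1 with rfl | he
  · exact hu
  · intro hv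
    rcases he.commandZone hv hu' with rfl | ⟨x, rfl⟩ <;> exact hu trivial

theorem Step.of_q {d : ℱ.Blocker} {v : ℱ.Vertex} (h : Step (.q d) v) : v = .q d :=
  h.1.resolve_right Edge.from_q

theorem Step.inCell {x : ℱ.Var} {u v : ℱ.Vertex} (h : Step u v) (hu : u.InCell x) :
    v.InCell x := by
  rcases h.1 with rfl | he
  · exact hu
  have hz := hu.not_commandZone
  rcases hu with ⟨b, rfl⟩ | ⟨b, rfl⟩ | ⟨d, rfl, -⟩
  · rcases he.from_value with rfl | ⟨d, rfl, hd⟩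
    · exact .inr (.inl ⟨_, rfl⟩)
    · exact .inr (.inr ⟨d, rfl, Vertex.ne_command_of_mem hz hd⟩)
  · rcases he.from_half with rfl | ⟨d, rfl, hd⟩
    · exact .inl ⟨_, rfl⟩
    · exact .inr (.inr ⟨d, rfl, Vertex.ne_command_of_mem hz hd⟩)
  · exact (Edge.from_q he).elim

theorem Step.from_value {x : ℱ.Var} {b : Bool} {v : ℱ.Vertex} (h : Step (.value x b) v) :
    v = .value x b ∨ v = .half x b ∨ ∃ d : ℱ.Blocker, v = .q d ∧ .value x b ∈ d.blocked :=
  h.1.imp_right Edge.from_value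

theorem Vertex.value_ne_half {x z : ℱ.Var} {b d : Bool} : Vertex.value x b ≠ .half z d := by
  cases b <;> cases d <;> exact nofun

theorem Vertex.value_ne_q {x : ℱ.Var} {b : Bool} {d : ℱ.Blocker} : Vertex.value x b ≠ .q d := by
  cases b <;> exact nofun

/-- A cop cannot change the value it represents within one step. -/
theorem Step.value_eq {x : ℱ.Var} {b b' : Bool} (h : Step (Vertex.value x b) (.value x b')) :
    b' = b := by
  rcases h.from_value with h | h | ⟨d, h, -⟩
  · exact (Vertex.value_inj h).2
  · exact (Vertex.value_ne_half h).elim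
  · exact (Vertex.value_ne_q h).elim

theorem Step.half_value_eq {x : ℱ.Var} {b b' : Bool} (h : Step (Vertex.half x b) (.value x b')) :
    b' = !b := by
  rcases h.1 with h | h
  · exact (Vertex.value_ne_half h).elim
  rcases h.from_half with h | ⟨d, h, -⟩
  · exact (Vertex.value_inj h).2
  · exact (Vertex.value_ne_q h).elim

theorem Step.nearGate {ψ : Fin ℱ.FC.length} {u v : ℱ.Vertex} (h : Step u v)
    (hu : u.NearGate ψ) (hu' : u ≠ .a' ψ) : v.NearGate ψ := by
  rcases h.1 with rfl | he
  · exact hu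
  rcases hu with rfl | rfl | ⟨i, rfl⟩
  · exact .inr he.from_a
  · exact (hu' rfl).elim
  · exact (Edge.from_q he).elim

/-- Walking two edges back from T_x. FT_x is missing, being three edges away, while G_x occurs
through GT_x: Commander there stands in for the cop of x. -/
theorem Step.step_T {x : ℱ.Var} {u m : ℱ.Vertex} (hu : u.InCopRegion) (h : Step u m)
    (h' : Step m (.T x)) : u = .T x ∨ u = .TF x ∨ u = .F x ∨ u = .GT x ∨ u = .G x := by
  rcases h'.1 with rfl | e'
  · rcases h.1 with rfl | e
    · exact .inl rfl
    · rcases e.into_T hu with rfl | rfl <;> simp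
  · rcases e'.into_T h.2 with rfl | rfl
    · rcases h.1 with rfl | e
      · simp
      · cases e with
        | F_TF => simp
    · rcases h.1 with rfl | e
      · simp
      · cases e with
        | G_GT => simp

theorem Step.step_F {x : ℱ.Var} {u m : ℱ.Vertex} (hu : u.InCopRegion) (h : Step u m)
    (h' : Step m (.F x)) : u = .F x ∨ u = .FT x ∨ u = .T x ∨ u = .GF x ∨ u = .G x := by
  rcases h'.1 with rfl | e'
  · rcases h.1 with rfl | e
    · exact .inl rfl
    · rcases e.into_F hu with rfl | rfl <;> simp
  · rcases e'.into_F h.2 with rfl | rfl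
    · rcases h.1 with rfl | e
      · simp
      · cases e with
        | T_FT => simp
    · rcases h.1 with rfl | e
      · simp
      · cases e with
        | G_GF => simp

theorem Step.step_a {ψ : Fin ℱ.FC.length} {u m : ℱ.Vertex} (hu : u.InCopRegion) (h : Step u m)
    (h' : Step m (.a ψ)) : u = .a ψ ∨ u = .a''' ψ ∨ u = .a'' := by
  rcases h'.1 with rfl | e'
  · rcases h.1 with rfl | e
    · exact .inl rfl
    · rw [e.into_a hu]; simp
  · obtain rfl := e'.into_a h.2
    rcases h.1 with rfl | e
    · simp
    · cases e with
      | a''_a''' => simp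

/-! ### Threats of Robber that pin the cops down -/

namespace Squad

/-- The variable cops are in their cells or stuck, and no clause cop has reached `a''`. -/
structure Roams (σ : ℱ.Squad) : Prop where
  var : ∀ x, (σ.var x).InCell x
  clause : ∀ ψ, (σ.clause ψ).NearGate ψ
  commander : σ.commander.InCopRegion

theorem Roams.inside {σ : ℱ.Squad} (h : σ.Roams) : σ.Inside :=
  ⟨fun x => (h.var x).inCopRegion, fun ψ => (h.clause ψ).inCopRegion, h.commander⟩

/-- A clause cop can leave its `NearGate` positions only from a'_ψ, towards a''. -/
theorem Roams.moves {σ σ' : ℱ.Squad} (h : σ.Roams) (ha : ∀ ψ, σ.clause ψ ≠ .a' ψ)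
    (hm : σ.Moves σ') : σ'.Roams :=
  ⟨fun x => (hm.var x).inCell (h.var x), fun ψ => (hm.clause ψ).nearGate (h.clause ψ) (ha ψ),
    hm.commander.2⟩

/-- All cop-region neighbours of a `command` vertex q lie in the zone reserved for Commander, so no
other cop can help him. -/
theorem wins_of_not_blocked {s : ℱ.Station} {σ : ℱ.Squad} (hσ : σ.Inside)
    (hv : ∀ x, ¬ (σ.var x).CommandZone) (ha : ∀ ψ, ¬ (σ.clause ψ).CommandZone)
    (hc : σ.commander ≠ .q (.command s)) (hc' : σ.commander ∉ (Blocker.command s).blocked) :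
    Wins (.station s) σ := by
  refine wins_of_blocker (b := .command s) hσ ?_
  have key : ∀ v : ℱ.Vertex, v.InCopRegion → ¬ v.CommandZone →
      ¬ (v = .q (.command s) ∨ ℱ.Edge v (.q (.command s))) := by
    rintro v hv hz (rfl | h)
    · exact hz trivial
    · rcases h.commandZone trivial hv with rfl | ⟨x, rfl⟩ <;> exact hz trivial
  rintro (⟨x, h⟩ | ⟨ψ, h⟩ | h | h)
  · exact key _ (hσ.var x) (hv x) h
  · exact key _ (hσ.clause ψ) (ha ψ) h
  · exact hc h
  · rcases h.into_q hσ.commander with h | ⟨-, φ, h⟩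
    · exact hc' h
    · cases h

theorem exists_next_station (s : ℱ.Station) :
    ∃ t : ℱ.Station, t ≠ s ∧ ℱ.Edge (.station s) (.station t) := by
  cases s with
  | RM => exact ⟨.RT, nofun, .RM_RT⟩
  | RT => exact ⟨.CM, nofun, .RT_CM⟩
  | CM => exact ⟨.RW, nofun, .CM_RW⟩
  | RW => exact ⟨.CT, nofun, .RW_CT⟩
  | CT => exact ⟨.RM, nofun, .CT_RM⟩
  | Sw y => exact ⟨.RT, nofun, .Sw_RT y⟩

/-- Commander has to be on a vertex that blocks the current station. -/
theorem Roams.wins_of_commander {s : ℱ.Station} {σ : ℱ.Squad} (hσ : σ.Roams)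
    (h : σ.commander ∈ (Blocker.command s).blocked → Wins (.station s) σ) :
    Wins (.station s) σ := by
  by_cases hb : σ.commander ∈ (Blocker.command s).blocked
  · exact h hb
  have hv := fun x => (hσ.var x).not_commandZone
  have ha := fun ψ => (hσ.clause ψ).not_commandZone
  -- Standing on q also guards the current station, but q is a sink: Robber moves on to another
  -- station, whose blocker Commander can no longer serve.
  by_cases hq : σ.commander = .q (.command s)
  · obtain ⟨t, hts, ht⟩ := exists_next_station s
    refine wins_of_step ht (fun h => h) hσ.inside fun σ' hm => ?_
    have hc : σ'.commander = .q (.command s) := Step.of_q (hq ▸ hm.commander)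
    refine wins_of_not_blocked hm.inside
      (fun x => (hm.var x).not_commandZone (hσ.inside.var x) (hv x))
      (fun ψ => (hm.clause ψ).not_commandZone (hσ.inside.clause ψ) (ha ψ)) ?_ ?_
    · rw [hc]
      intro h
      cases h
      exact hts rfl
    · rw [hc]
      intro h
      rcases Blocker.blocked_command h with h | ⟨_, h⟩ <;> cases h
  · exact wins_of_not_blocked hσ.inside hv ha hq hb

/-- The cop of `x` has to represent a value unless Commander is on `G_x`. -/
theorem Roams.wins_of_var {s : ℱ.Station} {σ : ℱ.Squad} (hσ : σ.Roams) (x : ℱ.Var)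
    (hc : σ.commander = .HQ ∨ ∃ z, z ≠ x ∧ σ.commander = .G z)
    (h : (∃ b, σ.var x = .value x b) → Wins (.station s) σ) : Wins (.station s) σ := by
  by_cases hx : ∃ b, σ.var x = .value x b
  · exact h hx
  have hT : σ.var x ≠ .T x := fun h => hx ⟨true, h⟩
  have hF : σ.var x ≠ .F x := fun h => hx ⟨false, h⟩
  have hother : ∀ z, z ≠ x → ∀ v, σ.var z = v →
      v ≠ .T x ∧ v ≠ .FT x ∧ v ≠ .F x ∧ v ≠ .TF x ∧ v ≠ .GT x ∧ v ≠ .GF x ∧ v ≠ .G x := by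
    rintro z hz v rfl
    rcases hσ.var z with ⟨b, h⟩ | ⟨b, h⟩ | ⟨d, h, -⟩ <;> rw [h]
    · cases b <;> simp [Vertex.value, hz]
    · cases b <;> simp [Vertex.half, hz]
    · simp
  have hclause : ∀ ψ v, σ.clause ψ = v →
      v ≠ .T x ∧ v ≠ .FT x ∧ v ≠ .F x ∧ v ≠ .TF x ∧ v ≠ .GT x ∧ v ≠ .GF x ∧ v ≠ .G x := by
    rintro ψ v rfl
    rcases hσ.clause ψ with h | h | ⟨i, h⟩ <;> rw [h] <;> simp
  have hcomm : σ.commander ≠ .T x ∧ σ.commander ≠ .FT x ∧ σ.commander ≠ .F x ∧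
      σ.commander ≠ .TF x ∧ σ.commander ≠ .GT x ∧ σ.commander ≠ .GF x ∧ σ.commander ≠ .G x := by
    rcases hc with h | ⟨z, hz, h⟩ <;> rw [h] <;> simp
    exact hz
  -- Off T_x and F_x one of the two targets is too far: F_x is three moves from TF_x, T_x is three
  -- moves from FT_x, and a cop stuck on some q reaches neither.
  by_cases hTF : σ.var x = .TF x
  · refine wins_of_enforcer hσ.inside (.station_forceF s) (.forceF_barF x) (.barF_F x)
      (fun h => h) (fun h => h) trivial ?_
    rintro (⟨z, m, h₁, h₂⟩ | ⟨ψ, m, h₁, h₂⟩ | ⟨m, h₁, h₂⟩)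
    · have := Step.step_F (hσ.inside.var z) h₁ h₂
      by_cases hz : z = x
      · subst hz; simp [hTF] at this
      · have := hother z hz _ rfl; tauto
    · have := Step.step_F (hσ.inside.clause ψ) h₁ h₂
      have := hclause ψ _ rfl; tauto
    · have := Step.step_F hσ.commander h₁ h₂
      tauto
  · refine wins_of_enforcer hσ.inside (.station_forceT s) (.forceT_barT x) (.barT_T x)
      (fun h => h) (fun h => h) trivial ?_
    rintro (⟨z, m, h₁, h₂⟩ | ⟨ψ, m, h₁, h₂⟩ | ⟨m, h₁, h₂⟩)
    · have := Step.step_T (hσ.inside.var z) h₁ h₂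
      by_cases hz : z = x
      · subst hz
        rcases hσ.var z with ⟨b, h⟩ | ⟨b, h⟩ | ⟨d, h, -⟩
        · exact hx ⟨b, h⟩
        · rw [h] at this hTF
          cases b <;> simp [Vertex.half] at this hTF
        · simp [h] at this
      · have := hother z hz _ rfl; tauto
    · have := Step.step_T (hσ.inside.clause ψ) h₁ h₂
      have := hclause ψ _ rfl; tauto
    · have := Step.step_T hσ.commander h₁ h₂
      tauto

/-- Except on `CT`, the cop of `ψ` has to be on `a_ψ`. -/
theorem Roams.wins_of_clause {s : ℱ.Station} {σ : ℱ.Squad} (hσ : σ.Roams) (hs : s ≠ .CT)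
    (hc : σ.commander = .HQ ∨ ∃ z, σ.commander = .G z) (ψ : Fin ℱ.FC.length)
    (h : σ.clause ψ = .a ψ → Wins (.station s) σ) : Wins (.station s) σ := by
  by_cases hψ : σ.clause ψ = .a ψ
  · exact h hψ
  refine wins_of_enforcer hσ.inside (.station_forceA s hs) (.forceA_barA ψ) (.barA_a ψ)
    (fun h => h) (fun h => h) trivial ?_
  rintro (⟨z, m, h₁, h₂⟩ | ⟨θ, m, h₁, h₂⟩ | ⟨m, h₁, h₂⟩)
  · have := Step.step_a (hσ.inside.var z) h₁ h₂
    rcases hσ.var z with ⟨b, h⟩ | ⟨b, h⟩ | ⟨d, h, -⟩ <;> rw [h] at this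
    · cases b <;> simp [Vertex.value] at this
    · cases b <;> simp [Vertex.half] at this
    · simp at this
  · have := Step.step_a (hσ.inside.clause θ) h₁ h₂
    rcases hσ.clause θ with h' | h' | ⟨i, h'⟩ <;> rw [h'] at this <;> simp at this
    subst this
    exact hψ h'
  · have := Step.step_a hσ.commander h₁ h₂
    rcases hc with h | ⟨z, h⟩ <;> rw [h] at this <;> simp at this

/-- If each of the conditions `P i` may be assumed in a proof of `W`, then all of them
together may. -/
theorem of_forall_imp {ι : Sort*} {W : Prop} {P : ι → Prop} (h : ∀ i, (P i → W) → W)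
    (hW : (∀ i, P i) → W) : W := by
  by_contra hn
  exact hn (hW fun i => by_contra fun hi => hn (h i fun hp => (hi hp).elim))

/-- Commander is forced onto HQ, hence protects no G_x, and all variable cops are pinned
simultaneously. -/
theorem Roams.wins_of_plain {s : ℱ.Station} {σ : ℱ.Squad} (hσ : σ.Roams)
    (hs : (Blocker.command s).blocked = {.HQ})
    (h : σ.commander = .HQ → (∀ x, ∃ b, σ.var x = .value x b) → Wins (.station s) σ) :
    Wins (.station s) σ := by
  refine hσ.wins_of_commander fun hc => ?_
  rw [hs, Set.mem_singleton_iff] at hc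
  exact of_forall_imp (fun x => hσ.wins_of_var x (.inl hc)) (h hc)

/-! ### Robber plays the formula game -/

theorem representing_roams (β : ℱ.Var → Bool) : (representing ℱ β).Roams :=
  ⟨fun _ => .inl ⟨_, rfl⟩, fun _ => .inl rfl, trivial⟩

/-- Robber arrives at a plain station, and the assignment represented before is still the same. -/
theorem wins_of_arrive {s : ℱ.Station} {σ σ' : ℱ.Squad} {β : ℱ.Var → Bool}
    (hs : (Blocker.command s).blocked = {.HQ}) (hs' : s ≠ .CT)
    (hσ : σ.Roams) (hv : ∀ x, σ.var x = .value x (β x)) (ha : ∀ ψ, σ.clause ψ ≠ .a' ψ)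
    (hm : σ.Moves σ') (h : Wins (.station s) (representing ℱ β)) : Wins (.station s) σ' := by
  have hσ' := hσ.moves ha hm
  refine hσ'.wins_of_plain hs fun hc hv' => ?_
  refine of_forall_imp (fun ψ => hσ'.wins_of_clause hs' (.inl hc) ψ) fun ha' => ?_
  suffices σ' = representing ℱ β from this ▸ h
  ext1
  · funext x
    obtain ⟨b, hb⟩ := hv' x
    have := hm.var x
    rw [hv x, hb] at this
    rw [hb, this.value_eq]
    rfl
  · exact funext ha'
  · exact hc

/-- The goal of player I, translated to the guarding game. -/
def Target : Player × (ℱ.Var → Bool) → Prop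
  | (.I, β) => ∀ σ : ℱ.Squad, σ.Roams → (∀ x, σ.var x = .value x (β x)) → σ.commander = .HQ →
      Wins (.station .CT) σ
  | (.II, β) => Wins (.station .RT) (representing ℱ β)

theorem wins_CT_of_target {σ σ' : ℱ.Squad} {β : ℱ.Var → Bool}
    (hσ : σ = representing ℱ β) (hm : σ.Moves σ') (h : Target (ℱ := ℱ) (.I, β)) :
    Wins (.station .CT) σ' := by
  subst hσ
  have hσ' := (representing_roams β).moves (fun ψ => by simp [representing]) hm
  refine hσ'.wins_of_plain rfl fun hc hv' => h σ' hσ' (fun x => ?_) hc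
  obtain ⟨b, hb⟩ := hv' x
  have := hm.var x
  rw [hb] at this
  rw [hb, Step.value_eq this]

theorem not_a'_representing (β : ℱ.Var → Bool) (ψ : Fin ℱ.FC.length) :
    (representing ℱ β).clause ψ ≠ .a' ψ := by simp [representing]

/-- Robber carries out player I's move: straight on to RT if nothing changes, otherwise through
Sw_y, which forces Commander onto G_y and the cop of y halfway to its other value. At RT Commander
must be back on HQ, and the flip has to be completed. -/
theorem wins_RM_of_target {β β' : ℱ.Var → Bool} (h₁ : ∀ x, β' (.inl x) = β (.inl x))
    (h₂ : {y | β' (.inr y) ≠ β (.inr y)}.Subsingleton) (h : Target (ℱ := ℱ) (.II, β')) :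
    Wins (.station .RM) (representing ℱ β) := by
  by_cases hβ : β' = β
  · subst hβ
    exact wins_of_step .RM_RT (fun h => h) (representing_inside _) fun σ hm =>
      wins_of_arrive rfl nofun (representing_roams _) (fun _ => rfl) (not_a'_representing _) hm h
  obtain ⟨y, hy⟩ : ∃ y, β' (.inr y) ≠ β (.inr y) := by
    by_contra! hn
    exact hβ (funext fun x => x.casesOn h₁ hn)
  have hβ' : ∀ x, x ≠ .inr y → β' x = β x := by
    rintro (x | z) hx
    · exact h₁ x
    · by_contra hz
      exact hx (congrArg _ (h₂ hz hy))
  refine wins_of_step (.RM_Sw y) (fun h => h) (representing_inside _) fun σ hm => ?_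
  have hσ := (representing_roams β).moves (not_a'_representing _) hm
  refine hσ.wins_of_commander fun hc => ?_
  change σ.commander = .G (.inr y) at hc
  refine of_forall_imp (fun ψ => hσ.wins_of_clause (by simp) (.inr ⟨_, hc⟩) ψ) fun ha => ?_
  refine of_forall_imp (fun x : {x // x ≠ Sum.inr y} =>
    hσ.wins_of_var x.1 (.inr ⟨_, x.2.symm, hc⟩)) fun hv => ?_
  have hv' : ∀ x, x ≠ .inr y → σ.var x = .value x (β x) := by
    intro x hx
    obtain ⟨b, hb⟩ := hv ⟨x, hx⟩
    have := hm.var x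
    rw [hb] at this
    rw [hb, Step.value_eq this]
  by_cases hhalf : σ.var (.inr y) = .half (.inr y) (β (.inr y))
  · refine wins_of_step (.Sw_RT y) (fun h => h) hm.inside fun σ' hm' => ?_
    have hσ' := hσ.moves (fun ψ => by simp [ha]) hm'
    refine hσ'.wins_of_plain rfl fun hc hv'' => ?_
    refine of_forall_imp (fun ψ => hσ'.wins_of_clause (by simp) (.inl hc) ψ) fun ha' => ?_
    suffices σ' = representing ℱ β' from this ▸ h
    ext1
    · funext x
      obtain ⟨b, hb⟩ := hv'' x
      have hs := hm'.var x
      rw [hb] at hs ⊢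
      change _ = Vertex.value x (β' x)
      by_cases hx : x = .inr y
      · subst hx
        rw [hhalf] at hs
        rw [hs.half_value_eq]
        congr 1
        revert hy
        cases β' (.inr y) <;> cases β (.inr y) <;> simp
      · rw [hv' x hx] at hs
        rw [hs.value_eq, hβ' x hx]
    · exact funext ha'
    · exact hc
  -- Here the cop of y still shows its old value or is stuck on the q of another blocker, and no
  -- other cop is near FT_y or TF_y.
  · refine wins_of_blocker (b := .robberSwitch y) hm.inside ?_
    have hmem : ∀ v, ℱ.Edge v (.q (.robberSwitch y)) → v.InCopRegion →
        v = .FT (.inr y) ∨ v = .TF (.inr y) := by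
      intro v h hv
      rcases h.into_q hv with h | ⟨-, φ, h⟩
      · exact h
      · cases h
    rintro (⟨x, h⟩ | ⟨ψ, h⟩ | h)
    · by_cases hx : x = .inr y
      · subst hx
        rcases (hm.var (.inr y)).from_value with h' | h' | ⟨d, h', hd⟩
        · rw [h'] at h
          rcases h with h | h
          · exact (Vertex.value_ne_q h).elim
          · have := hmem _ h (Vertex.value_inCopRegion _ _)
            revert this
            cases (β (.inr y)) <;> simp [Vertex.value]
        · exact hhalf h'
        · rw [h'] at h
          rcases h with h | h
          · cases h
            revert hd
            cases (β (.inr y)) <;> simp [Vertex.value, Blocker.blocked]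
          · exact Edge.from_q h
      · rw [hv' x hx] at h
        rcases h with h | h
        · exact (Vertex.value_ne_q h).elim
        · have := hmem _ h (Vertex.value_inCopRegion _ _)
          revert this
          cases (β x) <;> simp [Vertex.value]
    · rw [ha ψ] at h
      rcases h with h | h
      · cases h
      · simpa using hmem _ h trivial
    · rw [hc] at h
      rcases h with h | h
      · cases h
      · simpa using hmem _ h trivial

/-- With F_C false, leaving for a'_ψ is a mistake: Robber attacks the blocker of a false literal of
ψ, which only the cop of ψ could have covered. If nobody leaves, he goes on to RM, where the
enforcer punishes any clause cop that is not on a_ψ. -/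
theorem target_of_wins_RM {β : ℱ.Var → Bool} (hC : ¬ ℱ.Holds ℱ.FC β)
    (h : Wins (.station .RM) (representing ℱ β)) : Target (ℱ := ℱ) (.I, β) := by
  intro σ hσ hv hc
  by_cases ha : ∃ ψ, σ.clause ψ = .a' ψ
  · obtain ⟨ψ, hψ⟩ := ha
    obtain ⟨l, hl, hlβ⟩ : ∃ l ∈ ℱ.FC.get ψ, β l.1 ≠ l.2 := by
      by_contra! hn
      exact hC ⟨_, List.get_mem _ _, hn⟩
    obtain ⟨i, rfl⟩ := List.mem_iff_get.1 hl
    refine wins_of_blocker (b := .copGate ψ i) hσ.inside ?_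
    have hmem : ∀ v, ℱ.Edge v (.q (.copGate ψ i)) → v.InCopRegion →
        v = .value ((ℱ.FC.get ψ).get i).1 ((ℱ.FC.get ψ).get i).2 ∨ v = .a ψ ∨ v = .a'' := by
      intro v h hv
      rcases h.into_q hv with h | ⟨-, φ, h⟩
      · exact h
      · cases h
    rintro (⟨x, h⟩ | ⟨θ, h⟩ | h)
    · rw [hv x] at h
      rcases h with h | h
      · exact Vertex.value_ne_q h
      · rcases hmem _ h (Vertex.value_inCopRegion _ _) with h | h | h
        · obtain ⟨rfl, h⟩ := Vertex.value_inj h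
          exact hlβ h
        · revert h; cases β x <;> simp [Vertex.value]
        · revert h; cases β x <;> simp [Vertex.value]
    · have hne : θ = ψ → False := by
        rintro rfl
        rw [hψ] at h
        rcases h with h | h
        · cases h
        · rcases hmem _ h trivial with h | h | h
          · revert h; cases ((ℱ.FC.get θ).get i).2 <;> simp [Vertex.value]
          · cases h
          · cases h
      rcases hσ.clause θ with h' | h' | ⟨j, h'⟩ <;> rw [h'] at h
      · rcases h with h | h
        · cases h
        · rcases hmem _ h trivial with h | h | h
          · revert h; cases ((ℱ.FC.get ψ).get i).2 <;> simp [Vertex.value]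
          · cases h; exact hne rfl
          · cases h
      · rcases h with h | h
        · cases h
        · rcases hmem _ h trivial with h | h | h
          · revert h; cases ((ℱ.FC.get ψ).get i).2 <;> simp [Vertex.value]
          · cases h
          · cases h
      · rcases h with h | h
        · cases h; exact hne rfl
        · exact Edge.from_q h
    · rw [hc] at h
      rcases h with h | h
      · cases h
      · rcases hmem _ h trivial with h | h | h
        · revert h; cases ((ℱ.FC.get ψ).get i).2 <;> simp [Vertex.value]
        · cases h
        · cases h
  · push Not at ha
    exact wins_of_step .CT_RM (fun h => h) hσ.inside fun σ' hm =>
      wins_of_arrive rfl nofun hσ hv ha hm h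

/-- For a true clause φ every variable cop is on the vertex that does not block it, and a'' is
empty, so z_φ is open. -/
theorem target_two_of_holds {β : ℱ.Var → Bool} (hR : ℱ.Holds ℱ.FR β) :
    Target (ℱ := ℱ) (.II, β) := by
  obtain ⟨φ, hφ, hβ⟩ := hR
  obtain ⟨i, rfl⟩ := List.mem_iff_get.1 hφ
  refine wins_of_blocker (b := .robberGate i) (representing_inside β) ?_
  have hmem : ∀ v, ℱ.Edge v (.q (.robberGate i)) → v.InCopRegion →
      (∃ l ∈ ℱ.FR.get i, v = .value l.1 (!l.2)) ∨ v = .a'' := by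
    intro v h hv
    rcases h.into_q hv with h | ⟨h, -⟩
    · exact .inl h
    · exact .inr h
  rintro (⟨x, h | h⟩ | ⟨ψ, h | h⟩ | h | h)
  · exact Vertex.value_ne_q h
  · rcases hmem _ h (Vertex.value_inCopRegion _ _) with ⟨l, hl, h⟩ | h
    · obtain ⟨rfl, h⟩ := Vertex.value_inj h
      rw [hβ l hl] at h
      revert h
      cases l.2 <;> simp
    · revert h
      change Vertex.value x (β x) ≠ _
      cases β x <;> simp [Vertex.value]
  · cases h
  · rcases hmem _ h trivial with ⟨l, hl, h⟩ | h
    · revert h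
      change Vertex.a ψ ≠ _
      cases l.2 <;> simp [Vertex.value]
    · cases h
  · cases h
  · rcases hmem _ h trivial with ⟨l, hl, h⟩ | h
    · revert h
      change Vertex.HQ ≠ _
      cases l.2 <;> simp [Vertex.value]
    · cases h

/-- At CM Commander must be on HQ or on one G_x with x in C, and the other variable cops are pinned.
So whatever the cops do before RW amounts to changing at most one variable of C. -/
theorem target_two_of_moves {β : ℱ.Var → Bool}
    (h : ∀ β' : ℱ.Var → Bool, (∀ y, β' (.inr y) = β (.inr y)) →
      {x | β' (.inl x) ≠ β (.inl x)}.Subsingleton → Target (ℱ := ℱ) (.I, β')) :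
    Target (ℱ := ℱ) (.II, β) := by
  have hRW : ∀ β' : ℱ.Var → Bool, Target (ℱ := ℱ) (.I, β') →
      Wins (.station .RW) (representing ℱ β') := fun β' hβ' =>
    wins_of_step .RW_CT (fun h => h) (representing_inside _) fun σ hm =>
      wins_CT_of_target rfl hm hβ'
  refine wins_of_step .RT_CM (fun h => h) (representing_inside _) fun σ hm => ?_
  have hσ := (representing_roams β).moves (not_a'_representing _) hm
  refine hσ.wins_of_commander fun hc => ?_
  have hval : ∀ x, (∃ b, σ.var x = .value x b) → σ.var x = .value x (β x) := by
    rintro x ⟨b, hb⟩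
    have := hm.var x
    rw [hb] at this
    rw [hb, Step.value_eq this]
  rcases hc with hc | ⟨x, hc⟩
  · refine of_forall_imp (fun ψ => hσ.wins_of_clause (by simp) (.inl hc) ψ) fun ha => ?_
    refine of_forall_imp (fun x => hσ.wins_of_var x (.inl hc)) fun hv => ?_
    refine wins_of_step .CM_RW (fun h => h) hm.inside fun σ' hm' => ?_
    exact wins_of_arrive rfl nofun hσ (fun x => hval x (hv x)) (fun ψ => by simp [ha]) hm'
      (hRW β (h β (fun _ => rfl) (by simp)))
  · refine of_forall_imp (fun ψ => hσ.wins_of_clause (by simp) (.inr ⟨_, hc⟩) ψ) fun ha => ?_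
    refine of_forall_imp (fun z : {z // z ≠ Sum.inl x} =>
      hσ.wins_of_var z.1 (.inr ⟨_, z.2.symm, hc⟩)) fun hv => ?_
    refine wins_of_step .CM_RW (fun h => h) hm.inside fun σ' hm' => ?_
    have hσ' := hσ.moves (fun ψ => by simp [ha]) hm'
    refine hσ'.wins_of_plain rfl fun hc' hv' => ?_
    refine of_forall_imp (fun ψ => hσ'.wins_of_clause (by simp) (.inl hc') ψ) fun ha' => ?_
    -- The cop of x was unsupervised at CM and may now show either value; all others have kept
    -- theirs.
    choose β' hβ' using hv'
    have hne : ∀ z, z ≠ Sum.inl x → β' z = β z := by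
      intro z hz
      have hs := hm'.var z
      rw [hβ' z, hval z (hv ⟨z, hz⟩)] at hs
      exact hs.value_eq
    have : σ' = representing ℱ β' := by
      ext1
      exacts [funext hβ', funext ha', hc']
    rw [this]
    refine hRW β' (h β' (fun y => hne _ nofun) ?_)
    have hx : ∀ z, β' (Sum.inl z) ≠ β (Sum.inl z) → z = x := fun z hz => by
      by_contra hzx
      exact hz (hne _ fun e => hzx (Sum.inl_injective e))
    exact fun z hz z' hz' => (hx z hz).trans (hx z' hz').symm

theorem target_of_winsI {p : Player × (ℱ.Var → Bool)} (h : ℱ.WinsI p) : Target p := by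
  induction h with
  | one β q hm _ ih =>
    cases hm with
    | one _ β' hC h₁ h₂ => exact target_of_wins_RM hC (wins_RM_of_target h₁ h₂ ih)
  | two β _ ih =>
    -- If F_R is true, player II has no move and the induction hypothesis is void; Robber enters
    -- through the open gate instead.
    by_cases hR : ℱ.Holds ℱ.FR β
    · exact target_two_of_holds hR
    · exact target_two_of_moves fun β' h₁ h₂ => ih _ (.two β β' hR h₁ h₂)

end Squad

variable (ℱ) in
theorem robberWins_of_playerIWins (h : ℱ.PlayerIWins) : ℱ.toGuardingGame.RobberWins := by
  have hT := Squad.target_of_winsI h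
  change ℱ.toGuardingGame.RobberWinsFrom _ ℱ.copStart
  rw [Squad.copStart_eq]
  change Squad.Wins .start _
  cases hτ : ℱ.τ with
  | I =>
    rw [hτ] at hT
    exact Squad.wins_of_step (.start_CT hτ) (fun h => h) (Squad.representing_inside _)
      fun σ hm => Squad.wins_CT_of_target rfl hm hT
  | II =>
    rw [hτ] at hT
    exact Squad.wins_of_step (.start_RT hτ) (fun h => h) (Squad.representing_inside _)
      fun σ hm => Squad.wins_of_arrive rfl nofun (Squad.representing_roams _) (fun _ => rfl)
        (Squad.not_a'_representing _) hm hT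
/-! ### The strategy of the cops -/

theorem Edge.station_station {s t : ℱ.Station} (h : ℱ.Edge (.station s) (.station t)) :
    (s = .RM ∧ t = .RT) ∨ (s = .RT ∧ t = .CM) ∨ (s = .CM ∧ t = .RW) ∨ (s = .RW ∧ t = .CT) ∨
      (s = .CT ∧ t = .RM) ∨ (∃ y, s = .RM ∧ t = .Sw y) ∨ ∃ y, s = .Sw y ∧ t = .RT := by
  cases h <;> simp

/-- The vertex between `G_x` and the vertex that represents the value `b`. -/
def Vertex.guardValue (x : ℱ.Var) (b : Bool) : ℱ.Vertex := if b then .GT x else .GF x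

theorem Step.G_guardValue (x : ℱ.Var) (b : Bool) : Step (.G x) (Vertex.guardValue x b) := by
  cases b
  · exact .of_edge (.G_GF x) trivial
  · exact .of_edge (.G_GT x) trivial

theorem Step.guardValue_value (x : ℱ.Var) (b : Bool) :
    Step (Vertex.guardValue x b) (.value x b) := by
  cases b
  · exact .of_edge (.GF_F x) trivial
  · exact .of_edge (.GT_T x) trivial

theorem Step.value_half (x : ℱ.Var) (b : Bool) : Step (.value x b) (Vertex.half x b) :=
  .of_edge (.value_half x b) (Vertex.half_inCopRegion x b)

theorem Step.half_value (x : ℱ.Var) (b : Bool) : Step (.half x b) (Vertex.value x (!b)) :=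
  .of_edge (.half_value x b) (Vertex.value_inCopRegion x _)

namespace Squad

/-- A single cop can step to `v`. -/
theorem Inside.exists_moves_any {σ : ℱ.Squad} (hσ : σ.Inside) {v : ℱ.Vertex}
    (h : σ.Any (Step · v)) : ∃ σ' : ℱ.Squad, σ.Moves σ' ∧ σ'.Any (· = v) := by
  rcases h with ⟨x, h⟩ | ⟨ψ, h⟩ | h
  · refine ⟨⟨Function.update σ.var x v, σ.clause, σ.commander⟩,
      ⟨fun z => ?_, hσ.moves.clause, hσ.moves.commander⟩, .inl ⟨x, by simp⟩⟩
    rcases eq_or_ne z x with rfl | hz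
    · simpa using h
    · simpa [hz] using hσ.moves.var z
  · refine ⟨⟨σ.var, Function.update σ.clause ψ v, σ.commander⟩,
      ⟨hσ.moves.var, fun z => ?_, hσ.moves.commander⟩, .inr (.inl ⟨ψ, by simp⟩)⟩
    rcases eq_or_ne z ψ with rfl | hz
    · simpa using h
    · simpa [hz] using hσ.moves.clause z
  · exact ⟨⟨σ.var, σ.clause, v⟩, ⟨hσ.moves.var, hσ.moves.clause, h⟩, .inr (.inr rfl)⟩

/-- With Robber on the station `s`, the cops can respond to every move of Robber that leaves the
stations. -/
structure Guards (s : ℱ.Station) (σ : ℱ.Squad) : Prop where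
  inside : σ.Inside
  blocker : ∀ b : ℱ.Blocker, b.source = s → σ.Any (Step · (.q b))
  value : ∀ b, ∃ σ' : ℱ.Squad, σ.Moves σ' ∧ ∀ x, σ'.Any (Step · (.value x b))
  hub : s ≠ .CT → ℱ.FC ≠ [] → ∃ σ' : ℱ.Squad, σ.Moves σ' ∧ σ'.Any (Step · .a'')
  gate : s ≠ .CT → ∃ σ' : ℱ.Squad, σ.Moves σ' ∧ ∀ ψ, σ'.Any (Step · (.a ψ))

/-- The positions held by the cops outside of the stations, extended by an invariant `P` for the
stations. -/
def Holding (P : ℱ.Station → ℱ.Squad → Prop) (u : ℱ.Vertex) (σ : ℱ.Squad) : Prop :=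
  σ.Inside ∧ match u with
    | .start => σ = representing ℱ ℱ.α ∧ ¬ ℱ.PlayerIWins
    | .station s => P s σ
    | .p b => σ.Any (· = .q b)
    | .forceT => ∀ x, σ.Any (Step · (.T x))
    | .forceF => ∀ x, σ.Any (Step · (.F x))
    | .forceA => ∀ ψ, σ.Any (Step · (.a ψ))
    | .forceA'' => ℱ.FC ≠ [] → σ.Any (Step · .a'')
    | .barT x => σ.Any (· = .T x)
    | .barF x => σ.Any (· = .F x)
    | .barA ψ => σ.Any (· = .a ψ)
    | .barA'' => σ.Any (· = .a'')
    | _ => False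

/-- Off the stations Robber can only run down a blocker or an enforcer, where the cops have just
enough turns. Hence a station invariant need only imply `Guards` and survive the edges between
stations. -/
theorem Holding.step {P : ℱ.Station → ℱ.Squad → Prop}
    (hstart : ¬ ℱ.PlayerIWins → ∀ s, ℱ.Edge .start (.station s) →
      ∃ σ' : ℱ.Squad, (representing ℱ ℱ.α).Moves σ' ∧ P s σ')
    (hguard : ∀ s σ, P s σ → Guards s σ)
    (hnext : ∀ s t σ, P s σ → ℱ.Edge (.station s) (.station t) →
      ∃ σ' : ℱ.Squad, σ.Moves σ' ∧ P t σ')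
    {u v : ℱ.Vertex} {σ : ℱ.Squad} (h : Holding P u σ) (hv : v = u ∨ ℱ.Edge u v)
    (hfree : ¬ σ.Any (· = v)) :
    ¬ v.InCopRegion ∧ ∃ σ' : ℱ.Squad, σ.Moves σ' ∧ Holding P v σ' := by
  have hstation : ∀ {s t : ℱ.Station}, P s σ → ℱ.Edge (.station s) (.station t) →
      ¬ (Vertex.station t).InCopRegion ∧ ∃ σ' : ℱ.Squad, σ.Moves σ' ∧ Holding P (.station t) σ' :=
    fun hP he =>
      let ⟨σ', hm, h'⟩ := hnext _ _ _ hP he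
      ⟨fun h => h, σ', hm, hm.inside, h'⟩
  have hone : ∀ {w : ℱ.Vertex}, σ.Any (Step · w) → ∃ σ' : ℱ.Squad, σ.Moves σ' ∧
      σ'.Inside ∧ σ'.Any (· = w) := fun hw =>
    let ⟨σ', hm, h'⟩ := h.1.exists_moves_any hw
    ⟨σ', hm, hm.inside, h'⟩
  rcases hv with rfl | he
  · refine ⟨?_, σ, h.1.moves, h⟩
    have h2 := h.2
    intro hR
    cases v <;> first | exact hR.elim | exact h2.elim
  cases he with
  | start_CT hτ =>
    obtain ⟨hσ, rfl, hn⟩ := h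
    obtain ⟨σ', hm, h'⟩ := hstart hn _ (.start_CT hτ)
    exact ⟨fun h => h, σ', hm, hm.inside, h'⟩
  | start_RT hτ =>
    obtain ⟨hσ, rfl, hn⟩ := h
    obtain ⟨σ', hm, h'⟩ := hstart hn _ (.start_RT hτ)
    exact ⟨fun h => h, σ', hm, hm.inside, h'⟩
  | source_p b => exact ⟨fun h => h, hone ((hguard _ _ h.2).blocker b rfl)⟩
  | p_q b => exact (hfree h.2).elim
  | barT_T x => exact (hfree h.2).elim
  | barF_F x => exact (hfree h.2).elim
  | barA_a x => exact (hfree h.2).elim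
  | barA''_a'' => exact (hfree h.2).elim
  | station_forceT s =>
    obtain ⟨σ', hm, h'⟩ := (hguard _ _ h.2).value true
    exact ⟨fun h => h, σ', hm, hm.inside, h'⟩
  | station_forceF s =>
    obtain ⟨σ', hm, h'⟩ := (hguard _ _ h.2).value false
    exact ⟨fun h => h, σ', hm, hm.inside, h'⟩
  | station_forceA s hs =>
    obtain ⟨σ', hm, h'⟩ := (hguard _ _ h.2).gate hs
    exact ⟨fun h => h, σ', hm, hm.inside, h'⟩
  | station_forceA'' s hs =>
    refine ⟨fun h => h, ?_⟩
    -- Without clauses there is no cop to send to a'', but then the forcing vertex is a dead end.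
    by_cases hF : ℱ.FC = []
    · exact ⟨σ, h.1.moves, h.1, fun hn => (hn hF).elim⟩
    · obtain ⟨σ', hm, h'⟩ := (hguard _ _ h.2).hub hs hF
      exact ⟨σ', hm, hm.inside, fun _ => h'⟩
  | forceT_barT x => exact ⟨fun h => h, hone (h.2 x)⟩
  | forceF_barF x => exact ⟨fun h => h, hone (h.2 x)⟩
  | forceA_barA x => exact ⟨fun h => h, hone (h.2 x)⟩
  | forceA''_barA'' hF => exact ⟨fun h => h, hone (h.2 hF)⟩
  | blocked_q b _ hb =>
    have := Blocker.blocked_inCopRegion hb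
    obtain ⟨-, h2⟩ := h
    cases u <;> first | exact this.elim | exact h2.elim
  | RM_RT => exact hstation h.2 .RM_RT
  | RT_CM => exact hstation h.2 .RT_CM
  | CM_RW => exact hstation h.2 .CM_RW
  | RW_CT => exact hstation h.2 .RW_CT
  | CT_RM => exact hstation h.2 .CT_RM
  | RM_Sw y => exact hstation h.2 (.RM_Sw y)
  | Sw_RT y => exact hstation h.2 (.Sw_RT y)
  | _ => exact h.2.elim

/-- The cops of the variables and Commander can protect all vertices for the value `b`. -/
theorem Inside.exists_moves_value {σ : ℱ.Squad} (hσ : σ.Inside)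
    (h : ∀ x, (∃ d, σ.var x = .value x d) ∨ σ.commander = .G x) (b : Bool) :
    ∃ σ' : ℱ.Squad, σ.Moves σ' ∧ ∀ x, σ'.Any (Step · (.value x b)) := by
  have hvar : ∀ x, ∃ v, Step (σ.var x) v ∧
      ((∃ d, σ.var x = .value x d) → Step v (.value x b)) := by
    intro x
    by_cases hx : ∃ d, σ.var x = .value x d
    · obtain ⟨d, hd⟩ := hx
      by_cases hb : d = b
      -- A cop already on the demanded value waits; one on the opposite value uses both turns,
      -- through the half-way vertex.
      · exact ⟨_, .refl (hσ.var x), fun _ => by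
          rw [hd, hb]; exact .refl (Vertex.value_inCopRegion _ _)⟩
      · refine ⟨.half x d, hd ▸ .value_half x d, fun _ => ?_⟩
        have : b = !d := by revert hb; cases b <;> cases d <;> simp
        exact this ▸ .half_value x d
    · exact ⟨_, .refl (hσ.var x), fun h => (hx h).elim⟩
  choose v hv hv' using hvar
  by_cases hc : ∃ x, σ.commander = .G x
  · obtain ⟨x, hx⟩ := hc
    refine ⟨⟨v, σ.clause, Vertex.guardValue x b⟩,
      ⟨hv, hσ.moves.clause, hx ▸ .G_guardValue x b⟩, fun z => ?_⟩
    rcases h z with hz | hz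
    · exact .inl ⟨z, hv' z hz⟩
    · rw [hx] at hz
      cases hz
      exact .inr (.inr (.guardValue_value x b))
  · exact ⟨⟨v, σ.clause, σ.commander⟩, ⟨hv, hσ.moves.clause, hσ.moves.commander⟩,
      fun z => .inl ⟨z, hv' z ((h z).resolve_right fun hz => hc ⟨z, hz⟩)⟩⟩

/-- All clause cops are on their vertices `a_ψ`, except that one of them may be on `a''`. -/
def ClausesReady (σ : ℱ.Squad) : Prop :=
  (∀ ψ, σ.clause ψ = .a ψ) ∨ ∃ ψ, σ.clause ψ = .a'' ∧ ∀ θ, θ ≠ ψ → σ.clause θ = .a θ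

theorem Inside.exists_moves_gate {σ : ℱ.Squad} (hσ : σ.Inside) (h : σ.ClausesReady) :
    ∃ σ' : ℱ.Squad, σ.Moves σ' ∧ ∀ ψ, σ'.Any (Step · (.a ψ)) := by
  rcases h with h | ⟨ψ, hψ, h⟩
  · exact ⟨σ, hσ.moves, fun ψ => .inr (.inl ⟨ψ, ⟨.inl (h ψ).symm, trivial⟩⟩)⟩
  · refine ⟨⟨σ.var, Function.update σ.clause ψ (.a''' ψ), σ.commander⟩,
      ⟨hσ.moves.var, fun θ => ?_, hσ.moves.commander⟩, fun θ => .inr (.inl ⟨θ, ?_⟩)⟩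
    · rcases eq_or_ne θ ψ with rfl | hθ
      · simpa [hψ] using Step.of_edge (.a''_a''' θ) trivial
      · simpa [hθ] using hσ.moves.clause θ
    · rcases eq_or_ne θ ψ with rfl | hθ
      · simpa using Step.of_edge (.a'''_a θ) trivial
      · simpa [hθ, h] using Step.refl (u := Vertex.a θ) trivial

/-- A cop on a_ψ is exactly two edges from a'', so any single clause suffices. -/
theorem Inside.exists_moves_hub {σ : ℱ.Squad} (hσ : σ.Inside) (h : σ.ClausesReady)
    (hF : ℱ.FC ≠ []) : ∃ σ' : ℱ.Squad, σ.Moves σ' ∧ σ'.Any (Step · .a'') := by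
  rcases h with h | ⟨ψ, hψ, h⟩
  · let ψ : Fin ℱ.FC.length := ⟨0, List.length_pos_iff.2 hF⟩
    obtain ⟨σ', hm, h'⟩ := hσ.exists_moves_any (v := .a' ψ)
      (.inr (.inl ⟨ψ, h ψ ▸ .of_edge (.a_a' ψ) trivial⟩))
    refine ⟨σ', hm, h'.mono ?_⟩
    rintro _ rfl
    exact .of_edge (.a'_a'' ψ) trivial
  · exact ⟨σ, hσ.moves, .inr (.inl ⟨ψ, ⟨.inl hψ.symm, trivial⟩⟩)⟩

theorem guards_of {s : ℱ.Station} {σ : ℱ.Squad} (hσ : σ.Inside)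
    (hv : ∀ x, (∃ d, σ.var x = .value x d) ∨ σ.commander = .G x)
    (hc : σ.commander ∈ (Blocker.command s).blocked) (ha : s ≠ .CT → σ.ClausesReady)
    (hRT : s = .RT → ∀ φ, σ.Any (ℱ.Edge · (.q (.robberGate φ))))
    (hCT : s = .CT → ∀ ψ i, σ.Any (· ∈ (Blocker.copGate ψ i).blocked))
    (hSw : ∀ y, s = .Sw y → ∃ b, σ.var (.inr y) = .half (.inr y) b) : Guards s σ := by
  refine ⟨hσ, ?_, hσ.exists_moves_value hv, fun h => hσ.exists_moves_hub (ha h),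
    fun h => hσ.exists_moves_gate (ha h)⟩
  rintro (φ | ⟨ψ, i⟩ | y | t) rfl
  · exact (hRT rfl φ).mono fun v h => .of_edge h trivial
  · exact (hCT rfl ψ i).mono fun v h => .of_edge (.blocked_q _ _ h) trivial
  · obtain ⟨b, hb⟩ := hSw y rfl
    refine .inl ⟨.inr y, .of_edge (.blocked_q _ _ ?_) trivial⟩
    rw [hb]
    cases b
    · exact .inr rfl
    · exact .inl rfl
  · exact .inr (.inr (.of_edge (.blocked_q _ _ hc) trivial))

/-! ### The cops follow Robber along the stations -/

/-- The cops represent `β`, with arbitrary positions of the clause cops. -/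
def plain (β : ℱ.Var → Bool) (c : Fin ℱ.FC.length → ℱ.Vertex) : ℱ.Squad :=
  ⟨fun x => .value x (β x), c, .HQ⟩

/-- The cop of `x` is about to change its value, under the protection of Commander. -/
def flipping (β : ℱ.Var → Bool) (x : ℱ.Var) (c : Fin ℱ.FC.length → ℱ.Vertex) : ℱ.Squad :=
  ⟨Function.update (fun x => .value x (β x)) x (.half x (β x)), c, .G x⟩

theorem plain_inside {β : ℱ.Var → Bool} {c : Fin ℱ.FC.length → ℱ.Vertex}
    (hc : ∀ ψ, (c ψ).InCopRegion) : (plain β c).Inside :=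
  ⟨fun _ => Vertex.value_inCopRegion _ _, hc, trivial⟩

theorem flipping_inside {β : ℱ.Var → Bool} {x : ℱ.Var} {c : Fin ℱ.FC.length → ℱ.Vertex}
    (hc : ∀ ψ, (c ψ).InCopRegion) : (flipping β x c).Inside := by
  refine ⟨fun z => ?_, hc, trivial⟩
  rcases eq_or_ne z x with rfl | hz
  · simpa [flipping] using Vertex.half_inCopRegion _ _
  · simpa [flipping, hz] using Vertex.value_inCopRegion _ _

theorem plain_moves {β : ℱ.Var → Bool} {c c' : Fin ℱ.FC.length → ℱ.Vertex}
    (hc : ∀ ψ, Step (c ψ) (c' ψ)) : (plain β c).Moves (plain β c') :=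
  ⟨fun _ => .refl (Vertex.value_inCopRegion _ _), hc, .refl trivial⟩

theorem plain_moves_flipping {β : ℱ.Var → Bool} {c : Fin ℱ.FC.length → ℱ.Vertex}
    (hc : ∀ ψ, (c ψ).InCopRegion) (x : ℱ.Var) : (plain β c).Moves (flipping β x c) := by
  refine ⟨fun z => ?_, fun ψ => .refl (hc ψ), .of_edge (.HQ_G x) trivial⟩
  rcases eq_or_ne z x with rfl | hz
  · simpa [plain, flipping] using Step.value_half _ _
  · simpa [plain, flipping, hz] using Step.refl (Vertex.value_inCopRegion _ _)

theorem flipping_moves_plain {β : ℱ.Var → Bool} {c : Fin ℱ.FC.length → ℱ.Vertex}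
    (hc : ∀ ψ, (c ψ).InCopRegion) (x : ℱ.Var) :
    (flipping β x c).Moves (plain (Function.update β x (!β x)) c) := by
  refine ⟨fun z => ?_, fun ψ => .refl (hc ψ), .of_edge (.G_HQ x) trivial⟩
  rcases eq_or_ne z x with rfl | hz
  · simpa [plain, flipping] using Step.half_value _ _
  · simpa [plain, flipping, hz] using Step.refl (Vertex.value_inCopRegion _ _)

/-- The cop of `ψ` is on `v`, and the other clause cops are on their vertices `a_θ`. -/
def clauseAt (ψ : Fin ℱ.FC.length) (v : ℱ.Vertex) : Fin ℱ.FC.length → ℱ.Vertex :=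
  Function.update .a ψ v

theorem clauseAt_inCopRegion {ψ : Fin ℱ.FC.length} {v : ℱ.Vertex} (hv : v.InCopRegion)
    (θ : Fin ℱ.FC.length) : (clauseAt ψ v θ).InCopRegion := by
  rcases eq_or_ne θ ψ with rfl | hθ
  · simpa [clauseAt] using hv
  · simp [clauseAt, hθ, Vertex.InCopRegion]

theorem step_clauseAt {ψ : Fin ℱ.FC.length} {v w : ℱ.Vertex} (h : Step v w)
    (θ : Fin ℱ.FC.length) : Step (clauseAt ψ v θ) (clauseAt ψ w θ) := by
  rcases eq_or_ne θ ψ with rfl | hθ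
  · simpa [clauseAt] using h
  · simpa [clauseAt, hθ] using Step.refl (u := Vertex.a θ) trivial

/-- The positions in which the cops guard the stations. -/
inductive Patrol : ℱ.Station → ℱ.Squad → Prop
  | RM (β) : ¬ ℱ.WinsI (.I, β) → ¬ ℱ.Holds ℱ.FC β → Patrol .RM (plain β .a)
  | Sw (β) (y) : ¬ ℱ.WinsI (.I, β) → ¬ ℱ.Holds ℱ.FC β →
      Patrol (.Sw y) (flipping β (.inr y) .a)
  | RT (β) : ¬ ℱ.WinsI (.II, β) → Patrol .RT (plain β .a)
  | CM (β) : ¬ ℱ.WinsI (.I, β) → Patrol .CM (plain β .a)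
  | CM_flipping (β) (x) : ¬ ℱ.WinsI (.I, Function.update β (.inl x) (!β (.inl x))) →
      Patrol .CM (flipping β (.inl x) .a)
  | RW (β) : ¬ ℱ.WinsI (.I, β) → Patrol .RW (plain β .a)
  | CT (β) : ¬ ℱ.WinsI (.I, β) → ¬ ℱ.Holds ℱ.FC β → Patrol .CT (plain β .a)
  | CT_leaving (β) (ψ) : (∀ l ∈ ℱ.FC.get ψ, β l.1 = l.2) →
      Patrol .CT (plain β (clauseAt ψ (.a' ψ)))
  | hub (s) (β) (ψ) : (∀ y, s ≠ .Sw y) → Patrol s (plain β (clauseAt ψ .a''))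
  | hub_Sw (y) (β) (ψ) : Patrol (.Sw y) (flipping β (.inr y) (clauseAt ψ .a''))

theorem clausesReady_plain (β : ℱ.Var → Bool) : (plain β .a).ClausesReady := .inl fun _ => rfl

theorem flipping_value_or {β : ℱ.Var → Bool} {x : ℱ.Var} {c : Fin ℱ.FC.length → ℱ.Vertex}
    (z : ℱ.Var) : (∃ d, (flipping β x c).var z = .value z d) ∨
      (flipping β x c).commander = .G z := by
  rcases eq_or_ne z x with rfl | hz
  · exact .inr rfl
  · exact .inl ⟨β z, by simp [flipping, hz]⟩

theorem clauseAt_ready {σ : ℱ.Squad} {ψ : Fin ℱ.FC.length} (h : σ.clause = clauseAt ψ .a'') :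
    σ.ClausesReady :=
  .inr ⟨ψ, by simp [h, clauseAt], fun θ hθ => by simp [h, clauseAt, hθ]⟩

/-- Were player II without a legal move, `WinsI` would hold vacuously; so non-winning positions
provide a move and, in particular, a false F_R. -/
theorem exists_move_of_not_winsI {β : ℱ.Var → Bool} (h : ¬ ℱ.WinsI (.II, β)) :
    ∃ β', ℱ.Move (.II, β) (.I, β') ∧ ¬ ℱ.WinsI (.I, β') := by
  by_contra! hn
  refine h (.two β fun q hq => ?_)
  cases hq with
  | two _ β' h₁ h₂ h₃ => exact hn β' (.two _ _ h₁ h₂ h₃)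

/-- At RT, falsity of F_R puts a variable cop next to every z_φ. At CT each clause cop covers its
own gate from a_ψ; one that leaves is replaced by the variable cops of the literals of ψ, all true.
A cop on a'' covers every gate of both kinds. -/
theorem Patrol.guards {s : ℱ.Station} {σ : ℱ.Squad} (h : Patrol s σ) : Guards s σ := by
  have ha : ∀ ψ, (Vertex.a (ℱ := ℱ) ψ).InCopRegion := fun _ => trivial
  cases h with
  | RM β h₁ h₂ =>
    exact guards_of (plain_inside ha) (fun x => .inl ⟨_, rfl⟩) rfl
      (fun _ => clausesReady_plain β) nofun nofun nofun
  | Sw β y h₁ h₂ =>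
    exact guards_of (flipping_inside ha) flipping_value_or rfl
      (fun _ => .inl fun _ => rfl) nofun nofun
      fun z hz => by cases hz; exact ⟨β (.inr y), by simp [flipping]⟩
  | RT β h =>
    refine guards_of (plain_inside ha) (fun x => .inl ⟨_, rfl⟩) rfl
      (fun _ => clausesReady_plain β) (fun _ φ => ?_) nofun nofun
    obtain ⟨β', hm, -⟩ := exists_move_of_not_winsI h
    cases hm with
    | two _ _ hR =>
      obtain ⟨l, hl, hlβ⟩ : ∃ l ∈ ℱ.FR.get φ, β l.1 ≠ l.2 := by
        by_contra! hn
        exact hR ⟨_, List.get_mem _ _, hn⟩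
      refine .inl ⟨l.1, .blocked_q _ _ ⟨l, hl, ?_⟩⟩
      have : β l.1 = !l.2 := by revert hlβ; cases β l.1 <;> cases l.2 <;> simp
      rw [← this]
      rfl
  | CM β h =>
    exact guards_of (plain_inside ha) (fun x => .inl ⟨_, rfl⟩) (.inl rfl)
      (fun _ => clausesReady_plain β) nofun nofun nofun
  | CM_flipping β x h =>
    exact guards_of (flipping_inside ha) flipping_value_or (.inr ⟨x, rfl⟩)
      (fun _ => .inl fun _ => rfl) nofun nofun nofun
  | RW β h =>
    exact guards_of (plain_inside ha) (fun x => .inl ⟨_, rfl⟩) rfl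
      (fun _ => clausesReady_plain β) nofun nofun nofun
  | CT β h₁ h₂ =>
    exact guards_of (plain_inside ha) (fun x => .inl ⟨_, rfl⟩) rfl
      (fun _ => clausesReady_plain β) nofun (fun _ ψ i => .inr (.inl ⟨ψ, .inr (.inl rfl)⟩)) nofun
  | CT_leaving β ψ h =>
    refine guards_of (plain_inside (clauseAt_inCopRegion trivial)) (fun x => .inl ⟨_, rfl⟩) rfl
      (fun h => (h rfl).elim) nofun (fun _ θ i => ?_) nofun
    rcases eq_or_ne θ ψ with rfl | hθ
    · refine .inl ⟨((ℱ.FC.get θ).get i).1, .inl ?_⟩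
      rw [← h _ (List.get_mem _ i)]
      rfl
    · exact .inr (.inl ⟨θ, .inr (.inl (by simp [plain, clauseAt, hθ]))⟩)
  | hub _ β ψ hs =>
    refine guards_of (plain_inside (clauseAt_inCopRegion trivial)) (fun x => .inl ⟨_, rfl⟩) ?_
      (fun _ => clauseAt_ready rfl) (fun _ φ => ?_) (fun _ θ i => ?_) fun y hy => (hs y hy).elim
    · cases s with
      | Sw y => exact (hs y rfl).elim
      | CM => exact .inl rfl
      | _ => rfl
    · exact .inr (.inl ⟨ψ, by simpa [plain, clauseAt] using Edge.a''_z φ⟩)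
    · exact .inr (.inl ⟨ψ, .inr (.inr (by simp [plain, clauseAt]))⟩)
  | hub_Sw y β ψ =>
    exact guards_of (flipping_inside (clauseAt_inCopRegion trivial)) flipping_value_or rfl
      (fun _ => clauseAt_ready rfl) nofun nofun
      fun z hz => by cases hz; exact ⟨β (.inr y), by simp [flipping]⟩

theorem exists_patrol_CT {β : ℱ.Var → Bool} (h : ¬ ℱ.WinsI (.I, β)) :
    ∃ σ' : ℱ.Squad, (plain β .a).Moves σ' ∧ Patrol .CT σ' := by
  by_cases hC : ℱ.Holds ℱ.FC β
  · obtain ⟨ψ, hψ, hβ⟩ := hC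
    obtain ⟨i, rfl⟩ := List.mem_iff_get.1 hψ
    refine ⟨_, plain_moves fun θ => ?_, .CT_leaving β i hβ⟩
    rcases eq_or_ne θ i with rfl | hθ
    · simpa [clauseAt] using Step.of_edge (.a_a' θ) trivial
    · simpa [clauseAt, hθ] using Step.refl (u := Vertex.a θ) trivial
  · exact ⟨_, (plain_inside (c := .a) fun _ => trivial).moves, .CT β h hC⟩

theorem Patrol.exists_moves {s t : ℱ.Station} {σ : ℱ.Squad} (h : Patrol s σ)
    (ht : ℱ.Edge (.station s) (.station t)) : ∃ σ' : ℱ.Squad, σ.Moves σ' ∧ Patrol t σ' := by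
  have ha : ∀ ψ, (Vertex.a (ℱ := ℱ) ψ).InCopRegion := fun _ => trivial
  have ha' : ∀ ψ θ, (clauseAt (ℱ := ℱ) ψ .a'' θ).InCopRegion := fun _ =>
    clauseAt_inCopRegion trivial
  have ht := ht.station_station
  cases h with
  | RM β h₁ h₂ =>
    simp at ht
    rcases ht with rfl | ⟨y, rfl⟩
    -- Passing the switches is player I's move that changes nothing.
    · exact ⟨_, (plain_inside ha).moves,
        .RT β fun h => h₁ (.one β _ (.one _ _ h₂ (fun _ => rfl) (by simp)) h)⟩
    · exact ⟨_, plain_moves_flipping ha _, .Sw β y h₁ h₂⟩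
  | Sw β y h₁ h₂ =>
    simp at ht
    subst ht
    refine ⟨_, flipping_moves_plain ha _, .RT _ fun h => h₁ (.one β _ (.one _ _ h₂ ?_ ?_) h)⟩
    · simp
    · have : ∀ z, Function.update β (Sum.inr y) (!β (Sum.inr y)) (Sum.inr z) ≠ β (Sum.inr z) →
          z = y := fun z hz => by
        by_contra hzy
        exact hz (by simp [hzy])
      exact fun z hz z' hz' => (this z hz).trans (this z' hz').symm
  | RT β h =>
    simp at ht
    subst ht
    -- Player II's reply is chosen as Robber leaves RT, because a flip takes two turns: half-way
    -- when Robber reaches CM, complete when he reaches RW.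
    obtain ⟨β', hm, h'⟩ := exists_move_of_not_winsI h
    cases hm with
    | two _ _ hR h₁ h₂ =>
      by_cases hβ : β' = β
      · subst hβ
        exact ⟨_, (plain_inside ha).moves, .CM _ h'⟩
      obtain ⟨x, hx⟩ : ∃ x, β' (.inl x) ≠ β (.inl x) := by
        by_contra! hn
        exact hβ (funext fun x => x.casesOn hn h₁)
      have : β' = Function.update β (.inl x) (!β (.inl x)) := by
        funext z
        rcases eq_or_ne z (.inl x) with rfl | hz
        · rw [Function.update_self]
          revert hx
          cases β' (.inl x) <;> cases β (.inl x) <;> simp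
        · rw [Function.update_of_ne hz]
          rcases z with z | z
          · by_contra hne
            exact hz (congrArg _ (h₂ hne hx))
          · exact h₁ z
      exact ⟨_, plain_moves_flipping ha _, .CM_flipping β x (this ▸ h')⟩
  | CM β h =>
    simp at ht
    subst ht
    exact ⟨_, (plain_inside ha).moves, .RW β h⟩
  | CM_flipping β x h =>
    simp at ht
    subst ht
    exact ⟨_, flipping_moves_plain ha _, .RW _ h⟩
  | RW β h =>
    simp at ht
    subst ht
    exact exists_patrol_CT h
  | CT β h₁ h₂ =>
    simp at ht
    subst ht
    exact ⟨_, (plain_inside ha).moves, .RM β h₁ h₂⟩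
  | CT_leaving β ψ h =>
    simp at ht
    subst ht
    exact ⟨_, plain_moves (step_clauseAt (.of_edge (.a'_a'' ψ) trivial)), .hub _ β ψ nofun⟩
  | hub _ β ψ hs =>
    -- With a'' occupied the truth of the formulas is irrelevant, but a visit to Sw_y still demands
    -- a flip of y.
    by_cases hy : ∃ y, t = .Sw y
    · obtain ⟨y, rfl⟩ := hy
      exact ⟨_, plain_moves_flipping (ha' ψ) _, .hub_Sw y β ψ⟩
    · exact ⟨_, (plain_inside (ha' ψ)).moves,
        .hub t β ψ fun y hy' => hy ⟨y, hy'⟩⟩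
  | hub_Sw y β ψ =>
    simp at ht
    subst ht
    exact ⟨_, flipping_moves_plain (ha' ψ) _, .hub _ _ ψ nofun⟩

end Squad

variable (ℱ) in
theorem playerIWins_of_robberWins (h : ℱ.toGuardingGame.RobberWins) : ℱ.PlayerIWins := by
  by_contra hn
  change ℱ.toGuardingGame.RobberWinsFrom _ ℱ.copStart at h
  rw [Squad.copStart_eq] at h
  refine Squad.not_wins_of_invariant (Squad.Holding Squad.Patrol) (fun u σ v hS hv hf => ?_)
    (u := .start) ⟨Squad.representing_inside _, rfl, hn⟩ h
  refine Squad.Holding.step (fun hn s hs => ?_) (fun s σ => Squad.Patrol.guards)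
    (fun s t σ => Squad.Patrol.exists_moves) hS hv hf
  unfold PlayerIWins at hn
  cases hs with
  -- Entering CT from the start is like arriving from RW: if F_C is already true, a clause cop
  -- leaves at once.
  | start_CT hτ => exact Squad.exists_patrol_CT (hτ ▸ hn)
  | start_RT hτ => exact ⟨_, (Squad.representing_inside _).moves, .RT _ (hτ ▸ hn)⟩

end FormulaGame

/-! ### Lengths of the encodings -/

theorem length_fixedBits (w k : ℕ) : (fixedBits w k).length = w := by
  simp [fixedBits]

theorem length_encodeListWith {α : Type} (enc : α → List Bool) (l : List α) :
    (encodeListWith enc l).length = (l.map fun a => (enc a).length + 1).sum + 1 := by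
  simp [encodeListWith, List.length_flatMap]

/-- The number of edges, counted through adjacency lists, is at most the number of their names. -/
theorem sum_length_filter_le {V ι : Type} [Fintype ι] {n : ℕ} (Adj : V → V → Prop)
    [∀ u v, Decidable (Adj u v)] (e : V ≃ Fin n) (f : ι → V × V)
    (hf : ∀ u v, Adj u v → ∃ k, f k = (u, v)) :
    ∑ i, ((List.finRange n).filter fun j => decide (Adj (e.symm i) (e.symm j))).length ≤
      Fintype.card ι := by
  classical
  have h : ∀ i, ((List.finRange n).filter fun j => decide (Adj (e.symm i) (e.symm j))).length =
      (Finset.univ.filter fun j => Adj (e.symm i) (e.symm j)).card := by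
    intro i
    rw [← List.toFinset_card_of_nodup ((List.nodup_finRange n).filter _)]
    congr 1
    ext j
    simp
  rw [Finset.sum_congr rfl fun i _ => h i, ← Finset.card_sigma]
  refine (Finset.card_le_card (t := Finset.univ.image fun k =>
    (⟨e (f k).1, e (f k).2⟩ : Σ _ : Fin n, Fin n)) ?_).trans Finset.card_image_le
  rintro ⟨i, j⟩ h
  simp only [Finset.mem_sigma, Finset.mem_univ, Finset.mem_filter, true_and] at h
  obtain ⟨k, hk⟩ := hf _ _ h
  exact Finset.mem_image.2 ⟨k, Finset.mem_univ _, by simp [hk]⟩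

/-- Three bits per vertex (delimiter, membership, end of its list), two bits for the ends of the
outer lists, and at most a delimited name per edge, per cop and for Robber. -/
theorem GuardingGame.length_encode_le (𝒢 : GuardingGame)
    (e : 𝒢.V ≃ Fin (Fintype.card 𝒢.V)) {ι : Type} [Fintype ι] (f : ι → 𝒢.V × 𝒢.V)
    (hf : ∀ u v, 𝒢.graph.Adj u v → ∃ k, f k = (u, v)) :
    (𝒢.encode e).length ≤ 3 * Fintype.card 𝒢.V + 2 +
      (𝒢.nameWidth + 1) * (Fintype.card ι + 𝒢.c + 1) := by
  classical
  have h := sum_length_filter_le 𝒢.graph.Adj e f hf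
  have h' := Nat.mul_le_mul_left (𝒢.nameWidth + 1) h
  simp only [encode, List.length_append, length_encodeListWith, length_fixedBits,
    List.length_cons, ← Fin.sum_univ_def, List.map_const', List.sum_replicate, List.length_finRange,
    smul_eq_mul, Finset.sum_add_distrib, Finset.sum_const, Finset.card_univ, Fintype.card_fin]
  rw [Finset.mul_sum] at h'
  simp only [mul_comm (𝒢.nameWidth + 1)] at h' ⊢
  refine le_trans (b := 3 * Fintype.card 𝒢.V + 2 +
      (Fintype.card ι * (𝒢.nameWidth + 1) + 𝒢.c * (𝒢.nameWidth + 1) + (𝒢.nameWidth + 1))) ?_ ?_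
  · omega
  · apply le_of_eq; ring

/-! ### Counting vertices and edges -/

namespace FormulaGame

variable (ℱ : FormulaGame)

/-- The number of variables, clauses and literals. -/
def size : ℕ :=
  ℱ.nC + ℱ.nR + ℱ.FR.length + ℱ.FC.length + ∑ φ, (ℱ.FR.get φ).length + ∑ ψ, (ℱ.FC.get ψ).length

/-- Each clause costs a delimiter and an end mark, each literal a delimiter and a sign. Name bits
are ignored, as their width may be zero. -/
theorem length_encodeFormula_ge (Φ : List (List (ℱ.Var × Bool))) :
    2 * Φ.length + 2 * ∑ φ, (Φ.get φ).length + 1 ≤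
      (encodeListWith (encodeListWith ℱ.encodeLiteral) Φ).length := by
  have h : ∑ φ, (Φ.get φ).length = (Φ.map List.length).sum :=
    Fin.sum_univ_fun_getElem Φ List.length
  rw [h, length_encodeListWith]
  simp only [length_encodeListWith, encodeLiteral, List.length_cons, length_fixedBits,
    List.map_const', List.sum_replicate, smul_eq_mul]
  clear h
  induction Φ with
  | nil => simp
  | cons φ Φ ih =>
    simp only [List.map_cons, List.sum_cons, List.length_cons] at ih ⊢
    have : φ.length * 2 ≤ φ.length * (Nat.clog 2 (ℱ.nC + ℱ.nR) + 1 + 1) :=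
      Nat.mul_le_mul_left _ (by omega)
    omega

/-- The 5 consists of the bit for the player to move and the end marks of the four lists. -/
theorem two_mul_size_le : 2 * ℱ.size + 5 ≤ ℱ.encode.length := by
  have hR := ℱ.length_encodeFormula_ge ℱ.FR
  have hC := ℱ.length_encodeFormula_ge ℱ.FC
  have h₁ := length_encodeListWith (fun x => [ℱ.α (.inl x)]) (List.finRange ℱ.nC)
  have h₂ := length_encodeListWith (fun x => [ℱ.α (.inr x)]) (List.finRange ℱ.nR)
  simp only [List.length_singleton, List.map_const', List.sum_replicate, List.length_finRange,
    smul_eq_mul] at h₁ h₂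
  simp only [encode, List.length_cons, List.length_append, size]
  omega

theorem card_station_le : Fintype.card ℱ.Station ≤ 5 + ℱ.nR := by
  let f : Fin 5 ⊕ Fin ℱ.nR → ℱ.Station := Sum.elim ![.RM, .RT, .CM, .RW, .CT] .Sw
  have hf : Function.Surjective f := by
    intro s
    cases s with
    | RM => exact ⟨.inl 0, rfl⟩
    | RT => exact ⟨.inl 1, rfl⟩
    | CM => exact ⟨.inl 2, rfl⟩
    | RW => exact ⟨.inl 3, rfl⟩
    | CT => exact ⟨.inl 4, rfl⟩
    | Sw y => exact ⟨.inr y, rfl⟩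
  simpa using Fintype.card_le_of_surjective f hf

theorem card_blocker_le : Fintype.card ℱ.Blocker ≤
    ℱ.FR.length + ∑ ψ, (ℱ.FC.get ψ).length + ℱ.nR + Fintype.card ℱ.Station := by
  let f : ((Fin ℱ.FR.length ⊕ Σ ψ, Fin (ℱ.FC.get ψ).length) ⊕ Fin ℱ.nR) ⊕ ℱ.Station →
      ℱ.Blocker :=
    Sum.elim (Sum.elim (Sum.elim .robberGate fun i => .copGate i.1 i.2) .robberSwitch) .command
  have hf : Function.Surjective f := by
    intro b
    cases b with
    | robberGate φ => exact ⟨.inl (.inl (.inl φ)), rfl⟩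
    | copGate ψ i => exact ⟨.inl (.inl (.inr ⟨ψ, i⟩)), rfl⟩
    | robberSwitch y => exact ⟨.inl (.inr y), rfl⟩
    | command s => exact ⟨.inr s, rfl⟩
  simpa only [Fintype.card_sum, Fintype.card_fin, Fintype.card_sigma] using
    Fintype.card_le_of_surjective f hf

theorem card_vertex_le : Fintype.card ℱ.Vertex ≤ 8 + Fintype.card ℱ.Station +
    Fintype.card ℱ.Blocker * 2 + (ℱ.nC + ℱ.nR) * 9 + ℱ.FC.length * 4 := by
  let f : (((Fin 8 ⊕ ℱ.Station) ⊕ ℱ.Blocker × Fin 2) ⊕ ℱ.Var × Fin 9) ⊕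
      Fin ℱ.FC.length × Fin 4 → ℱ.Vertex :=
    Sum.elim (Sum.elim (Sum.elim (Sum.elim
      ![.start, .forceT, .forceF, .forceA, .forceA'', .barA'', .a'', .HQ] .station)
      fun b => ![.p b.1, .q b.1] b.2)
      fun x => ![.barT x.1, .barF x.1, .T x.1, .FT x.1, .F x.1, .TF x.1, .G x.1, .GT x.1,
        .GF x.1] x.2)
      fun ψ => ![.barA ψ.1, .a ψ.1, .a' ψ.1, .a''' ψ.1] ψ.2
  have hf : Function.Surjective f := by
    intro v
    cases v with
    | start => exact ⟨.inl (.inl (.inl (.inl 0))), rfl⟩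
    | forceT => exact ⟨.inl (.inl (.inl (.inl 1))), rfl⟩
    | forceF => exact ⟨.inl (.inl (.inl (.inl 2))), rfl⟩
    | forceA => exact ⟨.inl (.inl (.inl (.inl 3))), rfl⟩
    | forceA'' => exact ⟨.inl (.inl (.inl (.inl 4))), rfl⟩
    | barA'' => exact ⟨.inl (.inl (.inl (.inl 5))), rfl⟩
    | a'' => exact ⟨.inl (.inl (.inl (.inl 6))), rfl⟩
    | HQ => exact ⟨.inl (.inl (.inl (.inl 7))), rfl⟩
    | station s => exact ⟨.inl (.inl (.inl (.inr s))), rfl⟩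
    | p b => exact ⟨.inl (.inl (.inr (b, 0))), rfl⟩
    | q b => exact ⟨.inl (.inl (.inr (b, 1))), rfl⟩
    | barT x => exact ⟨.inl (.inr (x, 0)), rfl⟩
    | barF x => exact ⟨.inl (.inr (x, 1)), rfl⟩
    | T x => exact ⟨.inl (.inr (x, 2)), rfl⟩
    | FT x => exact ⟨.inl (.inr (x, 3)), rfl⟩
    | F x => exact ⟨.inl (.inr (x, 4)), rfl⟩
    | TF x => exact ⟨.inl (.inr (x, 5)), rfl⟩
    | G x => exact ⟨.inl (.inr (x, 6)), rfl⟩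
    | GT x => exact ⟨.inl (.inr (x, 7)), rfl⟩
    | GF x => exact ⟨.inl (.inr (x, 8)), rfl⟩
    | barA ψ => exact ⟨.inr (ψ, 0), rfl⟩
    | a ψ => exact ⟨.inr (ψ, 1), rfl⟩
    | a' ψ => exact ⟨.inr (ψ, 2), rfl⟩
    | a''' ψ => exact ⟨.inr (ψ, 3), rfl⟩
  simpa only [Fintype.card_sum, Fintype.card_prod, Fintype.card_fin] using
    Fintype.card_le_of_surjective f hf

/-- Names for the edges of the basic cycle, the enforcers, the cells and the Commander gadget. -/
abbrev PlainEdgeName : Type :=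
  ((((Fin 9 ⊕ Fin ℱ.nR × Fin 2) ⊕ ℱ.Blocker × Fin 2) ⊕ ℱ.Station × Fin 4) ⊕
    ℱ.Var × Fin 14) ⊕ (Fin ℱ.FC.length × Fin 6 ⊕ Fin ℱ.FR.length)

/-- Names for the edges into the vertices `q`. -/
abbrev BlockingEdgeName : Type :=
  (((Σ φ, Fin (ℱ.FR.get φ).length) ⊕ (Σ ψ, Fin (ℱ.FC.get ψ).length) × Fin 3) ⊕
    Fin ℱ.nR × Fin 3) ⊕ (ℱ.Station ⊕ Fin ℱ.nC)

variable {ℱ}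

/-- The edge with a given name. -/
def PlainEdgeName.edge : ℱ.PlainEdgeName → ℱ.Vertex × ℱ.Vertex :=
  Sum.elim (Sum.elim (Sum.elim (Sum.elim (Sum.elim
    ![(.start, .station .CT), (.start, .station .RT), (.station .RM, .station .RT),
      (.station .RT, .station .CM), (.station .CM, .station .RW), (.station .RW, .station .CT),
      (.station .CT, .station .RM), (.forceA'', .barA''), (.barA'', .a'')]
    fun y => ![(.station .RM, .station (.Sw y.1)), (.station (.Sw y.1), .station .RT)] y.2)
    fun b => ![(.station b.1.source, .p b.1), (.p b.1, .q b.1)] b.2)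
    fun s => ![(.station s.1, .forceT), (.station s.1, .forceF), (.station s.1, .forceA),
      (.station s.1, .forceA'')] s.2)
    fun x => ![(.forceT, .barT x.1), (.forceF, .barF x.1), (.barT x.1, .T x.1),
      (.barF x.1, .F x.1), (.T x.1, .FT x.1), (.FT x.1, .F x.1), (.F x.1, .TF x.1),
      (.TF x.1, .T x.1), (.HQ, .G x.1), (.G x.1, .HQ), (.G x.1, .GT x.1), (.GT x.1, .T x.1),
      (.G x.1, .GF x.1), (.GF x.1, .F x.1)] x.2)
    (Sum.elim
      (fun ψ => ![(.forceA, .barA ψ.1), (.barA ψ.1, .a ψ.1), (.a ψ.1, .a' ψ.1),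
        (.a' ψ.1, .a''), (.a'', .a''' ψ.1), (.a''' ψ.1, .a ψ.1)] ψ.2)
      fun φ => (.a'', .q (.robberGate φ)))

/-- The edge with a given name. -/
def BlockingEdgeName.edge : ℱ.BlockingEdgeName → ℱ.Vertex × ℱ.Vertex :=
  Sum.elim (Sum.elim (Sum.elim
    (fun i => (.value ((ℱ.FR.get i.1).get i.2).1 (!((ℱ.FR.get i.1).get i.2).2),
      .q (.robberGate i.1)))
    fun i => (![.value ((ℱ.FC.get i.1.1).get i.1.2).1 ((ℱ.FC.get i.1.1).get i.1.2).2, .a i.1.1,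
      .a''] i.2, .q (.copGate i.1.1 i.1.2)))
    fun y => ![(.FT (.inr y.1), .q (.robberSwitch y.1)), (.TF (.inr y.1), .q (.robberSwitch y.1)),
      (.G (.inr y.1), .q (.command (.Sw y.1)))] y.2)
    (Sum.elim (fun s => (.HQ, .q (.command s))) fun x => (.G (.inl x), .q (.command .CM)))

theorem BlockingEdgeName.exists_edge_eq {b : ℱ.Blocker} {v : ℱ.Vertex} (h : v ∈ b.blocked) :
    ∃ k : ℱ.BlockingEdgeName, k.edge = (v, .q b) := by
  cases b with
  | robberGate φ =>
    obtain ⟨l, hl, rfl⟩ := h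
    obtain ⟨i, rfl⟩ := List.mem_iff_get.1 hl
    exact ⟨.inl (.inl (.inl ⟨φ, i⟩)), rfl⟩
  | copGate ψ i =>
    rcases h with rfl | rfl | rfl
    · exact ⟨.inl (.inl (.inr (⟨ψ, i⟩, 0))), rfl⟩
    · exact ⟨.inl (.inl (.inr (⟨ψ, i⟩, 1))), rfl⟩
    · exact ⟨.inl (.inl (.inr (⟨ψ, i⟩, 2))), rfl⟩
  | robberSwitch y =>
    rcases h with rfl | rfl
    · exact ⟨.inl (.inr (y, 0)), rfl⟩
    · exact ⟨.inl (.inr (y, 1)), rfl⟩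
  | command s =>
    cases s with
    | Sw y =>
      cases h
      exact ⟨.inl (.inr (y, 2)), rfl⟩
    | CM =>
      rcases h with rfl | ⟨x, rfl⟩
      · exact ⟨.inr (.inl .CM), rfl⟩
      · exact ⟨.inr (.inr x), rfl⟩
    | _ =>
      cases h
      exact ⟨.inr (.inl _), rfl⟩

/-- For an upper bound the names only have to cover the edges; some denote non-edges, such as the
second edge out of the start. -/
theorem exists_edgeName {u v : ℱ.Vertex} (h : ℱ.Edge u v) :
    ∃ k : ℱ.PlainEdgeName ⊕ ℱ.BlockingEdgeName,
      Sum.elim PlainEdgeName.edge BlockingEdgeName.edge k = (u, v) := by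
  cases h with
  | blocked_q b v hb =>
    obtain ⟨k, hk⟩ := BlockingEdgeName.exists_edge_eq hb
    exact ⟨.inr k, hk⟩
  | start_CT => exact ⟨.inl (.inl (.inl (.inl (.inl (.inl 0))))), rfl⟩
  | start_RT => exact ⟨.inl (.inl (.inl (.inl (.inl (.inl 1))))), rfl⟩
  | RM_RT => exact ⟨.inl (.inl (.inl (.inl (.inl (.inl 2))))), rfl⟩
  | RT_CM => exact ⟨.inl (.inl (.inl (.inl (.inl (.inl 3))))), rfl⟩
  | CM_RW => exact ⟨.inl (.inl (.inl (.inl (.inl (.inl 4))))), rfl⟩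
  | RW_CT => exact ⟨.inl (.inl (.inl (.inl (.inl (.inl 5))))), rfl⟩
  | CT_RM => exact ⟨.inl (.inl (.inl (.inl (.inl (.inl 6))))), rfl⟩
  | forceA''_barA'' => exact ⟨.inl (.inl (.inl (.inl (.inl (.inl 7))))), rfl⟩
  | barA''_a'' => exact ⟨.inl (.inl (.inl (.inl (.inl (.inl 8))))), rfl⟩
  | RM_Sw y => exact ⟨.inl (.inl (.inl (.inl (.inl (.inr (y, 0)))))), rfl⟩
  | Sw_RT y => exact ⟨.inl (.inl (.inl (.inl (.inl (.inr (y, 1)))))), rfl⟩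
  | source_p b => exact ⟨.inl (.inl (.inl (.inl (.inr (b, 0))))), rfl⟩
  | p_q b => exact ⟨.inl (.inl (.inl (.inl (.inr (b, 1))))), rfl⟩
  | station_forceT s => exact ⟨.inl (.inl (.inl (.inr (s, 0)))), rfl⟩
  | station_forceF s => exact ⟨.inl (.inl (.inl (.inr (s, 1)))), rfl⟩
  | station_forceA s => exact ⟨.inl (.inl (.inl (.inr (s, 2)))), rfl⟩
  | station_forceA'' s => exact ⟨.inl (.inl (.inl (.inr (s, 3)))), rfl⟩
  | forceT_barT x => exact ⟨.inl (.inl (.inr (x, 0))), rfl⟩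
  | forceF_barF x => exact ⟨.inl (.inl (.inr (x, 1))), rfl⟩
  | barT_T x => exact ⟨.inl (.inl (.inr (x, 2))), rfl⟩
  | barF_F x => exact ⟨.inl (.inl (.inr (x, 3))), rfl⟩
  | T_FT x => exact ⟨.inl (.inl (.inr (x, 4))), rfl⟩
  | FT_F x => exact ⟨.inl (.inl (.inr (x, 5))), rfl⟩
  | F_TF x => exact ⟨.inl (.inl (.inr (x, 6))), rfl⟩
  | TF_T x => exact ⟨.inl (.inl (.inr (x, 7))), rfl⟩
  | HQ_G x => exact ⟨.inl (.inl (.inr (x, 8))), rfl⟩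
  | G_HQ x => exact ⟨.inl (.inl (.inr (x, 9))), rfl⟩
  | G_GT x => exact ⟨.inl (.inl (.inr (x, 10))), rfl⟩
  | GT_T x => exact ⟨.inl (.inl (.inr (x, 11))), rfl⟩
  | G_GF x => exact ⟨.inl (.inl (.inr (x, 12))), rfl⟩
  | GF_F x => exact ⟨.inl (.inl (.inr (x, 13))), rfl⟩
  | forceA_barA ψ => exact ⟨.inl (.inr (.inl (ψ, 0))), rfl⟩
  | barA_a ψ => exact ⟨.inl (.inr (.inl (ψ, 1))), rfl⟩
  | a_a' ψ => exact ⟨.inl (.inr (.inl (ψ, 2))), rfl⟩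
  | a'_a'' ψ => exact ⟨.inl (.inr (.inl (ψ, 3))), rfl⟩
  | a''_a''' ψ => exact ⟨.inl (.inr (.inl (ψ, 4))), rfl⟩
  | a'''_a ψ => exact ⟨.inl (.inr (.inl (ψ, 5))), rfl⟩
  | a''_z φ => exact ⟨.inl (.inr (.inr φ)), rfl⟩

variable (ℱ)

theorem card_vertex_le_encode : Fintype.card ℱ.Vertex ≤ 16 * ℱ.encode.length := by
  have h₁ := ℱ.card_station_le
  have h₂ := ℱ.card_blocker_le
  have h₃ := ℱ.card_vertex_le
  have h₄ := ℱ.two_mul_size_le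
  unfold size at h₄
  omega

theorem card_edgeName_add_le : Fintype.card (ℱ.PlainEdgeName ⊕ ℱ.BlockingEdgeName) +
    (ℱ.nC + ℱ.nR + ℱ.FC.length + 1) + 1 ≤ 32 * ℱ.encode.length := by
  have h₁ := ℱ.card_station_le
  have h₂ := ℱ.card_blocker_le
  have h₄ := ℱ.two_mul_size_le
  unfold size at h₄
  simp only [Fintype.card_sum, Fintype.card_prod, Fintype.card_fin, Fintype.card_sigma]
  omega

/-! ### The bound of order L log L -/

theorem two_le_logb {L : ℕ} (hL : 4 ≤ L) : 2 ≤ Real.logb 2 (L : ℝ) := by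
  rw [Real.le_logb_iff_rpow_le (by norm_num) (by positivity)]
  norm_num
  exact hL

/-- The left side is at most log(16 L) + 2 = log L + 6, and 6 ≤ 3 log L because log L ≥ 2. -/
theorem clog_le_of_le_mul {N L : ℕ} (hL : 4 ≤ L) (hN : N ≤ 16 * L) :
    (Nat.clog 2 N + 1 : ℝ) ≤ 4 * Real.logb 2 L := by
  have hlog := two_le_logb hL
  have h₁ : (Nat.clog 2 N : ℝ) ≤ Nat.clog 2 (16 * L) := by
    exact_mod_cast Nat.clog_mono_right 2 hN
  have h₂ : (Nat.clog 2 (16 * L) : ℝ) ≤ Real.logb 2 (16 * L) + 1 := by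
    rw [← Real.natCeil_logb_natCast]
    push_cast
    refine (Nat.ceil_lt_add_one (Real.logb_nonneg (by norm_num) ?_)).le
    have : (4 : ℝ) ≤ L := by exact_mod_cast hL
    linarith
  have h₃ : Real.logb 2 (16 * L) = 4 + Real.logb 2 L := by
    rw [Real.logb_mul (by norm_num) (by positivity)]
    congr 1
    rw [Real.logb_eq_iff_rpow_eq] <;> norm_num
  linarith

theorem length_encode_toGuardingGame_le
    (e : ℱ.toGuardingGame.V ≃ Fin (Fintype.card ℱ.toGuardingGame.V)) :
    ((ℱ.toGuardingGame.encode e).length : ℝ) ≤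
      153 * (ℱ.encode.length * Real.logb 2 ℱ.encode.length) := by
  have h := ℱ.toGuardingGame.length_encode_le e
    (Sum.elim PlainEdgeName.edge BlockingEdgeName.edge) fun u v => exists_edgeName
  have hN : Fintype.card ℱ.toGuardingGame.V ≤ 16 * ℱ.encode.length := ℱ.card_vertex_le_encode
  have hE : Fintype.card (ℱ.PlainEdgeName ⊕ ℱ.BlockingEdgeName) + ℱ.toGuardingGame.c + 1 ≤
    32 * ℱ.encode.length := ℱ.card_edgeName_add_le
  have hL : 5 ≤ ℱ.encode.length := le_trans (Nat.le_add_left 5 _) ℱ.two_mul_size_le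
  have hw := clog_le_of_le_mul (by omega) hN
  change (ℱ.toGuardingGame.nameWidth + 1 : ℝ) ≤ _ at hw
  have hw1 := two_le_logb (L := ℱ.encode.length) (by omega)
  have h' : ((ℱ.toGuardingGame.encode e).length : ℝ) ≤
      3 * Fintype.card ℱ.toGuardingGame.V + 2 + (ℱ.toGuardingGame.nameWidth + 1) *
        ((Fintype.card (ℱ.PlainEdgeName ⊕ ℱ.BlockingEdgeName) + ℱ.toGuardingGame.c + 1 : ℕ) :
          ℝ) := by
    exact_mod_cast h
  have hN' : (Fintype.card ℱ.toGuardingGame.V : ℝ) ≤ 16 * ℱ.encode.length := by exact_mod_cast hN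
  have hE' : ((Fintype.card (ℱ.PlainEdgeName ⊕ ℱ.BlockingEdgeName) + ℱ.toGuardingGame.c + 1 : ℕ)
    : ℝ) ≤ 32 * ℱ.encode.length := by exact_mod_cast hE
  have hL' : (5 : ℝ) ≤ ℱ.encode.length := by exact_mod_cast hL
  have hprod := mul_le_mul hw hE' (Nat.cast_nonneg _) (by linarith)
  -- The length is at most 48 L + 2 + 128 L log L; since log L ≥ 2, the first two terms are at most
  -- 24 L log L and L log L, and 24 + 1 + 128 = 153.
  nlinarith [mul_le_mul_of_nonneg_left hw1 (by linarith : (0 : ℝ) ≤ ℱ.encode.length)]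

end FormulaGame

theorem mainTheorem5 :
    ∃ K : ℝ, ∀ ℱ : FormulaGame,
      (ℱ.PlayerIWins ↔ ℱ.toGuardingGame.RobberWins) ∧
      (∀ e : ℱ.toGuardingGame.V ≃ Fin (Fintype.card ℱ.toGuardingGame.V),
        ((ℱ.toGuardingGame.encode e).length : ℝ) ≤
          K * (ℱ.encode.length * Real.logb 2 ℱ.encode.length)) ∧
      (∀ v, ¬ ℱ.toGuardingGame.graph.Adj v ℱ.toGuardingGame.r) ∧
      Function.Injective ℱ.toGuardingGame.S ∧
      (∀ u ∈ ℱ.toGuardingGame.border, ℱ.toGuardingGame.outDegree u = 1) :=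
  ⟨153, fun ℱ => ⟨⟨ℱ.robberWins_of_playerIWins, ℱ.playerIWins_of_robberWins⟩,
    ℱ.length_encode_toGuardingGame_le, fun _ => FormulaGame.Edge.into_start,
    FormulaGame.copStart_injective, FormulaGame.outDegree_border⟩⟩
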